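/- **Setting.** Let $G_0$ be a real Lie group whose Lie algebra $\mathfrak g_0$ has simple complexification $\mathfrak g$, and let $\kappa$ be the opposite of the Killing form. Let $N\ge 1$, let $z_1,\dots,z_N$ be distinct real numbers, $\ell_r\neq 0$, $k_r$ and $\ell^\infty\ne0$ real with $k_N=0$, and $$\varphi(z)=\sum_{r=1}^N\Bigl(\frac{\ell_r}{(z-z_r)^2}-\frac{2k_r}{z-z_r}\Bigr)-\ell^\infty .$$ Assume that $\varphi$ has $2N$ distinct zeros $\zeta_1,\dots,\zeta_{2N}\in\mathbb C\setminus\{z_r\}$, with signs $\epsilon_i=\pm1$, $N$ of each sign, complex conjugate zeros having the same sign (no condition if all zeros are real). Put $I_\pm=\{i:\epsilon_i=\pm1\}$ and $$\varphi_{\pm,r}(z)=\frac{\prod_{i\in I_\pm}(z-\zeta_i)}{\prod_{s\ne r}(z-z_s)},\qquad \rho_{rr}=\tfrac{\ell^\infty}{4}\bigl(\varphi_{+,r}'(z_r)\varphi_{-,r}(z_r)-\varphi_{+,r}(z_r)\varphi_{-,r}'(z_r)\bigr),\qquad \rho_{rs}=\tfrac{\ell^\infty}{2}\frac{\varphi_{+,r}(z_r)\varphi_{-,s}(z_s)}{z_r-z_s}\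 (r\neq s),$$ and $\vartheta=2\rho_{NN}/\ell_N$. Let $R:\mathfrak g_0\to\mathfrak g_0$ be linear, $\kappa$-skew-symmetric, a solution of $[RX,RY]=R([RX,Y]+[X,RY])$, and such that $1-\vartheta R$ is invertible; $R_g=\mathrm{Ad}_g^{-1}R\,\mathrm{Ad}_g$. For fields $g_r(t,x)\in G_0$ put $j^{(r)}_0=g_r^{-1}\partial_tg_r$, $j^{(r)}=g_r^{-1}\partial_xg_r$, $j^{(r)}_\pm=j_0^{(r)}\pm j^{(r)}$ and $R^{(N)}=R_{g_N}$. For $r<N$ the field $g_r$ takes values in an open set on which the 3-form $\Omega(ga,gb,gc)=\kappa(a,[b,c])$ has a smooth primitive 2-form $\Lambda_r$; $W^{(r)}\in\mathfrak g_0$ is defined by $\kappa(W^{(r)},b)=\Lambda_r(\partial_xg_r,g_rb)$, and the Wess–Zumino term is $I_{WZ}[g_r]=\iint \Lambda_r(\partial_xg_r,\partial_tg_r)\,dx\,dt=\iint\kappa(W^{(r)},j^{(r)}_0)\,dx\,dt$. **The models.** The phase space is $T^*G_0^N$-valued fields $(g_r,X_r)$, $X_r\in\mathfrak g_0$ being the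 momentum in the left trivialisation. The Gaudin Lax matrix of the undeformed coupled model is $$\Gamma(z)=\sum_{r=1}^N\Bigl(\frac{\ell_rj^{(r)}}{(z-z_r)^2}+\frac{X_r-k_rj^{(r)}-k_rW^{(r)}}{z-z_r}\Bigr);$$ that of the deformed model, $\Gamma_{hYB}$, is obtained by replacing the term $r=N$ by $\frac{\ell_Nj^{(N)}-R^{(N)}X_N}{(z-z_N)^2}+\frac{X_N}{z-z_N}$. Each model has the Hamiltonian $\mathcal H=\sum_i\epsilon_i\mathcal Q_i$, $\mathcal Q_i=-\frac1{2\varphi'(\zeta_i)}\int dx\,\kappa(\Gamma(\zeta_i),\Gamma(\zeta_i))$, and the Lax pair $\mathcal L_\pm(z)=\mathcal M(z)\pm\mathcal L(z)$ with $\mathcal L(z)=\Gamma(z)/\varphi(z)$ and $\mathcal M(z)=\sum_i\frac{\epsilon_i}{\varphi'(\zeta_i)}\frac{\Gamma(\zeta_i)}{z-\zeta_i}$. Its action is the inverse Legendre transform $S[g_1,\dots,g_N]=\sum_r\iint\kappa(X_r,j_0^{(r)})\,dx\,dt-\int\mathcal H\,dt$, where the $X_r$ are expressed through the fields $g_r$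 by Hamilton's equation $\partial_tg_r=\{\mathcal H,g_r\}$, i.e. $j_0^{(r)}$ is the $\kappa$-gradient of the Hamiltonian density with respect to $X_r$. **Claim.** The numbers $\rho_{rs}$ and the Hamiltonian densities are real, and $1\pm\vartheta R_h$ is invertible for every $h\in G_0$. For smooth fields $g_1,\dots,g_N$ as above: 1. For the undeformed and for the deformed model the equations $\partial_tg_r=\{\mathcal H,g_r\}$ determine the momenta $X_r$ uniquely. 2. The deformed model has the action $$S[g_1,\dots,g_N]=\iint dt\,dx\sum_{r,s=1}^N\kappa\bigl(j^{(r)}_+,\mathcal O_{rs}\,j^{(s)}_-\bigr)+\sum_{r=1}^{N-1}k_r\,I_{WZ}[g_r],\qquad \mathcal O_{rs}=\rho_{rs}+\frac{2\rho_{rN}\rho_{Ns}}{\ell_N}\frac{R^{(N)}}{1-\vartheta R^{(N)}} .$$ The equality holds for the Lagrangian densities at every point of space-time, for the actions over every product of a compact set of times and a compact set of positions, and over every product of measurable sets on which the densities $\kappa(X_r,j^{(r)}_0)$, $\sum_{r,s}\kappa(j_+^{(r)},\mathcal O_{rs}j_-^{(s)})$ and $\Lambda_r(\partial_xg_r,\partial_tg_r)$,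 $r<N$, are integrable. Moreover $\mathcal O_{rN}=\frac{\rho_{rN}}{1-\vartheta R^{(N)}}$ and $\mathcal O_{Nr}=\frac{\rho_{Nr}}{1-\vartheta R^{(N)}}$ for all $r$. 3. For every $z\in\mathbb C$ different from all $z_r$ and $\zeta_i$, the Lax pair of the undeformed model is $\mathcal L_\pm(z)=\sum_{r=1}^N\frac{\varphi_{\pm,r}(z_r)}{\varphi_{\pm,r}(z)}j^{(r)}_\pm$, and that of the deformed model is obtained from it by replacing $j_\pm^{(N)}$ with $J_\pm^{(N)}$: $$\mathcal L^{hYB}_\pm(z)=\sum_{r=1}^{N-1}\frac{\varphi_{\pm,r}(z_r)}{\varphi_{\pm,r}(z)}j^{(r)}_\pm+\frac{\varphi_{\pm,N}(z_N)}{\varphi_{\pm,N}(z)}J^{(N)}_\pm,\qquad J^{(N)}_\pm=\frac1{1\pm\vartheta R^{(N)}}\Bigl(j_\pm^{(N)}\mp\frac2{\ell_N}\sum_{r=1}^{N-1}a^\pm_rR^{(N)}j_\pm^{(r)}\Bigr),$$ with $a_r^+=\rho_{rN}$ and $a_r^-=\rho_{Nr}$. -/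

import Mathlib

open scoped TensorProduct Manifold ContDiff BigOperators
open MeasureTheory

noncomputable section

namespace CoupledHYB

/-! ### Parameters of the coupled model with `N = n + 1` sites

The sites are labelled by `Fin (n + 1)`; the distinguished last site is `Fin.last n`. -/

/-- Positions `z_r`, levels `ℓ_r` and `k_r`, constant term `ℓ^∞`, the `2N` zeros `ζ_i` of the twist
function and the signs `ε_i` attached to them. -/
structure GaudinData (n : ℕ) where
  z : Fin (n + 1) → ℝ
  ell : Fin (n + 1) → ℝ
  k : Fin (n + 1) → ℝ
  ellInf : ℝ
  zeta : Fin (2 * (n + 1)) → ℂ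
  eps : Fin (2 * (n + 1)) → ℤˣ

/-- A sign, seen as a real number. -/
def sgn (s : ℤˣ) : ℝ := ((s : ℤ) : ℝ)

namespace GaudinData

variable {n : ℕ} (D : GaudinData n)

/-- The twist function `φ(w) = ∑_r (ℓ_r / (w - z_r)² - 2 k_r / (w - z_r)) - ℓ^∞`. -/
def twist (w : ℂ) : ℂ :=
  ∑ r, ((D.ell r : ℂ) / (w - D.z r) ^ 2 - 2 * (D.k r : ℂ) / (w - D.z r)) - (D.ellInf : ℂ)

/-- The standing assumptions: distinct positions, non-zero highest levels and constant term, the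
`ζ_i` are `2N` distinct (hence simple, hence all) zeros of the twist function, as many signs `+1` as
signs `-1`, and the signs are compatible with complex conjugation of the zeros (automatic when the
zeros are real; this is what makes the Hamiltonian real). -/
structure Admissible : Prop where
  z_injective : Function.Injective D.z
  ell_ne_zero : ∀ r, D.ell r ≠ 0
  ellInf_ne_zero : D.ellInf ≠ 0
  zeta_injective : Function.Injective D.zeta
  zeta_ne : ∀ i r, D.zeta i ≠ (D.z r : ℂ)
  twist_zeta : ∀ i, D.twist (D.zeta i) = 0
  card_plus : (Finset.univ.filter fun i => D.eps i = 1).card = n + 1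
  conj_zeta : ∀ i, ∃ i', D.zeta i' = (starRingEnd ℂ) (D.zeta i) ∧ D.eps i' = D.eps i

/-- `φ_{±,r}(w) = ∏_{i ∈ I_±} (w - ζ_i) / ∏_{q ≠ r} (w - z_q)`, where `I_± = {i | ε_i = ±1}`. -/
def phi (s : ℤˣ) (r : Fin (n + 1)) (w : ℂ) : ℂ :=
  (∏ i ∈ Finset.univ.filter (fun i => D.eps i = s), (w - D.zeta i)) /
    ∏ q ∈ Finset.univ.erase r, (w - D.z q)

/-- The coefficients `ρ_{rs}`, as complex numbers. -/
def rhoC (r s : Fin (n + 1)) : ℂ :=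
  if r = s then
    (D.ellInf : ℂ) / 4 *
      (deriv (D.phi 1 r) (D.z r) * D.phi (-1) r (D.z r) -
        D.phi 1 r (D.z r) * deriv (D.phi (-1) r) (D.z r))
  else
    (D.ellInf : ℂ) / 2 * (D.phi 1 r (D.z r) * D.phi (-1) s (D.z s) / ((D.z r : ℂ) - D.z s))

/-- The coefficients `ρ_{rs}` as real numbers (they have no imaginary part). -/
def rho (r s : Fin (n + 1)) : ℝ := (D.rhoC r s).re

/-- `ϑ = 2 ρ_{NN} / ℓ_N`. -/
def theta : ℝ := 2 * D.rho (Fin.last n) (Fin.last n) / D.ell (Fin.last n)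

end GaudinData

/-! ### Pointwise algebra: Gaudin Lax matrix, Hamiltonian density, Lax pair -/

section Algebra

variable {L : Type*} [LieRing L] [LieAlgebra ℝ L] {n : ℕ} (D : GaudinData n)

/-- `κ`, the opposite of the Killing form of the real Lie algebra `𝔤₀`. -/
def kap : LinearMap.BilinForm ℝ L := -killingForm ℝ L

/-- `κ` on the complexification `𝔤 = ℂ ⊗ 𝔤₀`. -/
def kapC : LinearMap.BilinForm ℂ (ℂ ⊗[ℝ] L) := -killingForm ℂ (ℂ ⊗[ℝ] L)

/-- The element of `𝔤₀` that represents a linear form through `κ` (`κ` is non-degenerate when `𝔤₀`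
is semisimple; the value `0` otherwise is irrelevant). -/
def sharp [Module.Finite ℝ L] (f : Module.Dual ℝ L) : L :=
  open Classical in
  if h : (kap : LinearMap.BilinForm ℝ L).Nondegenerate then
    (LinearMap.BilinForm.toDual (kap : LinearMap.BilinForm ℝ L) h).symm f
  else 0

/-- Currents `𝒥_{(r),[0]} = X_r - k_r j_r - k_r W_r` of the PCM+WZ realisation. -/
def pcmCurrent0 (j W X : Fin (n + 1) → L) (r : Fin (n + 1)) : L :=
  X r - D.k r • j r - D.k r • W r

/-- Currents `𝒥_{(r),[1]} = ℓ_r j_r` of the PCM+WZ realisation. -/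
def pcmCurrent1 (j : Fin (n + 1) → L) (r : Fin (n + 1)) : L := D.ell r • j r

/-- The currents `𝒥_{(r),[0]}` after the last site has received the homogeneous Yang-Baxter
realisation `𝒥_{[0]} = X`. -/
def hybCurrent0 (j W X : Fin (n + 1) → L) : Fin (n + 1) → L :=
  Function.update (pcmCurrent0 D j W X) (Fin.last n) (X (Fin.last n))

/-- The currents `𝒥_{(r),[1]}` after the last site has received the homogeneous Yang-Baxter
realisation `𝒥_{[1]} = ℓ j - R_g X`. -/
def hybCurrent1 (Rg : Module.End ℝ L) (j X : Fin (n + 1) → L) : Fin (n + 1) → L :=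
  Function.update (pcmCurrent1 D j) (Fin.last n)
    (D.ell (Fin.last n) • j (Fin.last n) - Rg (X (Fin.last n)))

/-- The Gaudin Lax matrix `Γ(w) = ∑_r (𝒥_{(r),[1]} / (w - z_r)² + 𝒥_{(r),[0]} / (w - z_r))`. -/
def gaudinLax (A0 A1 : Fin (n + 1) → L) (w : ℂ) : ℂ ⊗[ℝ] L :=
  ∑ r, ((1 / (w - D.z r) ^ 2) ⊗ₜ[ℝ] A1 r + (1 / (w - D.z r)) ⊗ₜ[ℝ] A0 r)

/-- The density of `∑_i ε_i 𝒬_i`, where `𝒬_i = - 1 / (2 φ'(ζ_i)) ∫ κ(Γ(ζ_i), Γ(ζ_i)) dx`. -/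
def hamDensityC (A0 A1 : Fin (n + 1) → L) : ℂ :=
  ∑ i, (sgn (D.eps i) : ℂ) *
    (-(1 / (2 * deriv D.twist (D.zeta i))) *
      kapC (gaudinLax D A0 A1 (D.zeta i)) (gaudinLax D A0 A1 (D.zeta i)))

/-- The Hamiltonian density as a real number (it has no imaginary part). -/
def hamDensity (A0 A1 : Fin (n + 1) → L) : ℝ := (hamDensityC D A0 A1).re

/-- Spatial component `ℒ(w) = Γ(w) / φ(w)` of the Lax pair. -/
def laxL (A0 A1 : Fin (n + 1) → L) (w : ℂ) : ℂ ⊗[ℝ] L :=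
  (1 / D.twist w) • gaudinLax D A0 A1 w

/-- Temporal component `ℳ(w) = ∑_i ε_i / φ'(ζ_i) * Γ(ζ_i) / (w - ζ_i)` of the Lax pair. -/
def laxM (A0 A1 : Fin (n + 1) → L) (w : ℂ) : ℂ ⊗[ℝ] L :=
  ∑ i, ((sgn (D.eps i) : ℂ) / deriv D.twist (D.zeta i) / (w - D.zeta i)) •
    gaudinLax D A0 A1 (D.zeta i)

/-- Light-cone components `ℒ_±(w) = ℳ(w) ± ℒ(w)` of the Lax pair. -/
def laxPair (s : ℤˣ) (A0 A1 : Fin (n + 1) → L) (w : ℂ) : ℂ ⊗[ℝ] L :=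
  laxM D A0 A1 w + (sgn s : ℂ) • laxL D A0 A1 w

/-- The expression `∑_r φ_{±,r}(z_r) / φ_{±,r}(w) c_r` in given currents `c_r`. -/
def interpolatedLax (s : ℤˣ) (c : Fin (n + 1) → L) (w : ℂ) : ℂ ⊗[ℝ] L :=
  ∑ r, (D.phi s r (D.z r) / D.phi s r w) ⊗ₜ[ℝ] c r

/-- The first Hamilton equation in the left trivialisation of `T^*G₀^N`. From
`{X₁(x), g₂(y)} = g₂(x) C₁₂ δ(x - y)` one has `g_r⁻¹ {∫ h, g_r} = ∂h/∂X_r` (gradient with respect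
to `κ`) for a density `h` without derivatives of `X`; `v` is this gradient at `X`. -/
def IsVelocity (h : (Fin (n + 1) → L) → ℝ) (X v : Fin (n + 1) → L) : Prop :=
  ∀ (r : Fin (n + 1)) (Y : L),
    HasDerivAt (fun a : ℝ => h (Function.update X r (X r + a • Y))) (kap (v r) Y) 0

/-- The current
`J^{(N)}_± = (1 ± ϑ R_g)⁻¹ (j^{(N)}_± ∓ (2 / ℓ_N) ∑_{r < N} a^±_r R_g j^{(r)}_±)` with
`a^+_r = ρ_{rN}` and `a^-_r = ρ_{Nr}`, as a function of `c_r = j^{(r)}_±`. -/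
def deformedCurrent (Rg : Module.End ℝ L) (s : ℤˣ) (c : Fin (n + 1) → L) : L :=
  Ring.inverse (1 + (sgn s * D.theta) • Rg)
    (c (Fin.last n) - (sgn s * (2 / D.ell (Fin.last n))) •
      ∑ r ∈ Finset.univ.erase (Fin.last n),
        (if s = 1 then D.rho r (Fin.last n) else D.rho (Fin.last n) r) • Rg (c r))

/-- The operators `𝒪_{rs} = ρ_{rs} + (2 ρ_{rN} ρ_{Ns} / ℓ_N) R_g (1 - ϑ R_g)⁻¹`. -/
def opO (Rg : Module.End ℝ L) (r s : Fin (n + 1)) : Module.End ℝ L :=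
  D.rho r s • (1 : Module.End ℝ L) +
    (2 * D.rho r (Fin.last n) * D.rho (Fin.last n) s / D.ell (Fin.last n)) •
      (Rg * Ring.inverse (1 - D.theta • Rg))

/-- The homogeneous classical Yang-Baxter equation. -/
def IsHomogeneousYB (R : Module.End ℝ L) : Prop :=
  ∀ X Y : L, ⁅R X, R Y⁆ - R (⁅R X, Y⁆ + ⁅X, R Y⁆) = 0

/-- Skew-symmetry with respect to `κ`. -/
def IsSkew (R : Module.End ℝ L) : Prop :=
  ∀ X Y : L, kap (R X) Y = -kap X (R Y)

end Algebra

/-! ### Fields on space-time with values in the Lie group `G₀`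

A space-time point is `p = (t, x) : ℝ × ℝ`. -/

section Fields

variable {E : Type*} [NormedAddCommGroup E] [NormedSpace ℝ E] [FiniteDimensional ℝ E]
  {G : Type*} [TopologicalSpace G] [ChartedSpace E G] [Group G]

/-- A smooth Lie group is of the class `C³` in which the Lie algebra of a Lie group is built. -/
instance instLieGroupMinSmoothness [LieGroup 𝓘(ℝ, E) ∞ G] :
    LieGroup 𝓘(ℝ, E) (minSmoothness ℝ 3) G :=
  LieGroup.of_le (n := ∞) (by
    rw [minSmoothness_of_isRCLikeNormedField]
    exact ENat.LEInfty.out)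

instance instCompleteSpaceModel (E : Type*) [NormedAddCommGroup E] [NormedSpace ℝ E]
    [FiniteDimensional ℝ E] : CompleteSpace E :=
  FiniteDimensional.complete ℝ E

instance : Module.Finite ℝ (GroupLieAlgebra 𝓘(ℝ, E) G) :=
  inferInstanceAs (Module.Finite ℝ E)

/-- The adjoint action `Ad_g`: the derivative at `1` of `h ↦ g h g⁻¹`. -/
def Ad (g : G) : Module.End ℝ (GroupLieAlgebra 𝓘(ℝ, E) G) :=
  let T : E →L[ℝ] E := mfderiv 𝓘(ℝ, E) 𝓘(ℝ, E) (fun h : G => g * h * g⁻¹) 1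
  (T : E →ₗ[ℝ] E)

/-- `R_g = Ad_g⁻¹ ∘ R ∘ Ad_g`. -/
def conjR (R : Module.End ℝ (GroupLieAlgebra 𝓘(ℝ, E) G)) (g : G) :
    Module.End ℝ (GroupLieAlgebra 𝓘(ℝ, E) G) :=
  Ad g⁻¹ * R * Ad g

/-- `g⁻¹ ∂_u g` for a field `g` and a direction `u` in space-time. -/
def leftCurrent (g : ℝ × ℝ → G) (u : ℝ × ℝ) (p : ℝ × ℝ) : GroupLieAlgebra 𝓘(ℝ, E) G :=
  let T : E →L[ℝ] E := mfderiv 𝓘(ℝ, E) 𝓘(ℝ, E) (fun h : G => (g p)⁻¹ * h) (g p)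
  let v : E := mfderiv 𝓘(ℝ, ℝ × ℝ) 𝓘(ℝ, E) g p u
  T v

variable {n : ℕ}

/-- `j^{(r)}_0 = g_r⁻¹ ∂_t g_r`. -/
def jT (g : Fin (n + 1) → ℝ × ℝ → G) (p : ℝ × ℝ) (r : Fin (n + 1)) :
    GroupLieAlgebra 𝓘(ℝ, E) G := leftCurrent (g r) (1, 0) p

/-- `j^{(r)} = g_r⁻¹ ∂_x g_r`. -/
def jX (g : Fin (n + 1) → ℝ × ℝ → G) (p : ℝ × ℝ) (r : Fin (n + 1)) :
    GroupLieAlgebra 𝓘(ℝ, E) G := leftCurrent (g r) (0, 1) p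

/-- `j^{(r)}_± = g_r⁻¹ ∂_± g_r` with `∂_± = ∂_t ± ∂_x`. -/
def jLC (g : Fin (n + 1) → ℝ × ℝ → G) (s : ℤˣ) (p : ℝ × ℝ) (r : Fin (n + 1)) :
    GroupLieAlgebra 𝓘(ℝ, E) G := jT g p r + sgn s • jX g p r

/-- A 2-form `Λ` on `G₀` in the left trivialisation: `B g a b = Λ_g(g a, g b)`. -/
abbrev TwoForm (E G : Type*) [NormedAddCommGroup E] [NormedSpace ℝ E] [TopologicalSpace G]
    [ChartedSpace E G] [Group G] : Type _ :=
  G → GroupLieAlgebra 𝓘(ℝ, E) G →ₗ[ℝ] GroupLieAlgebra 𝓘(ℝ, E) G →ₗ[ℝ] ℝ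

/-- The current `W` of a site: `κ(W, b) = Λ(∂_x g, g b)` for all `b ∈ 𝔤₀`. -/
def wzCurrent [LieGroup 𝓘(ℝ, E) ∞ G] (B : Fin (n + 1) → TwoForm E G)
    (g : Fin (n + 1) → ℝ × ℝ → G) (p : ℝ × ℝ) (r : Fin (n + 1)) : GroupLieAlgebra 𝓘(ℝ, E) G :=
  sharp (B r (g r p) (jX g p r))

/-- Derivative of a function on `G₀` along the left-invariant vector field `a`. -/
def leftDeriv (a : GroupLieAlgebra 𝓘(ℝ, E) G) (f : G → ℝ) (g : G) : ℝ :=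
  mfderiv 𝓘(ℝ, E) 𝓘(ℝ, ℝ) f g (mulInvariantVectorField a g)

/-- `B` is a smooth 2-form on the open set `U` with `dΛ = Ω` there, where `Ω` is the canonical
3-form `Ω_g(g a, g b, g c) = κ(a, [b, c])`; the exterior derivative is written on left-invariant
vector fields. -/
structure IsWZPrimitive [LieGroup 𝓘(ℝ, E) ∞ G] (U : Set G) (B : TwoForm E G) : Prop where
  isOpen : IsOpen U
  alternating : ∀ g ∈ U, ∀ a, B g a a = 0
  smooth : ∀ a b, ContMDiffOn 𝓘(ℝ, E) 𝓘(ℝ, ℝ) ∞ (fun g => B g a b) U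
  d_eq : ∀ g ∈ U, ∀ a b c : GroupLieAlgebra 𝓘(ℝ, E) G,
    leftDeriv a (fun h => B h b c) g + leftDeriv b (fun h => B h c a) g +
        leftDeriv c (fun h => B h a b) g -
      B g ⁅a, b⁆ c - B g ⁅b, c⁆ a - B g ⁅c, a⁆ b = kap a ⁅b, c⁆

/-- The Wess-Zumino term of one field over the window `T × S` of space-time, written with a
primitive `Λ` of `Ω`: `∫∫ Λ(∂_x g, ∂_t g) dx dt`. -/
def wzTerm (B : TwoForm E G) (g : ℝ × ℝ → G) (T S : Set ℝ) : ℝ :=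
  ∫ t in T, ∫ x in S, B (g (t, x)) (leftCurrent g (0, 1) (t, x)) (leftCurrent g (1, 0) (t, x))

variable [LieGroup 𝓘(ℝ, E) ∞ G] (D : GaudinData n)
  (R : Module.End ℝ (GroupLieAlgebra 𝓘(ℝ, E) G)) (B : Fin (n + 1) → TwoForm E G)
  (g : Fin (n + 1) → ℝ × ℝ → G)

/-- Hamiltonian density of the undeformed coupled model at `p`, as a function of the momenta. -/
def undefHam (p : ℝ × ℝ) (X : Fin (n + 1) → GroupLieAlgebra 𝓘(ℝ, E) G) : ℝ :=
  hamDensity D (pcmCurrent0 D (jX g p) (wzCurrent B g p) X) (pcmCurrent1 D (jX g p))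

/-- Hamiltonian density of the deformed model at `p`, as a function of the momenta. -/
def hybHam (p : ℝ × ℝ) (X : Fin (n + 1) → GroupLieAlgebra 𝓘(ℝ, E) G) : ℝ :=
  hamDensity D (hybCurrent0 D (jX g p) (wzCurrent B g p) X)
    (hybCurrent1 D (conjR R (g (Fin.last n) p)) (jX g p) X)

/-- `X` is the momentum field of the undeformed model along `g`, i.e. `∂_t g_r = {ℋ, g_r}`. -/
def IsUndefMomentum (X : ℝ × ℝ → Fin (n + 1) → GroupLieAlgebra 𝓘(ℝ, E) G) : Prop :=
  ∀ p, IsVelocity (undefHam D B g p) (X p) (jT g p)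

/-- `X` is the momentum field of the deformed model along `g`, i.e. `∂_t g_r = {ℋ_hYB, g_r}`. -/
def IsHybMomentum (X : ℝ × ℝ → Fin (n + 1) → GroupLieAlgebra 𝓘(ℝ, E) G) : Prop :=
  ∀ p, IsVelocity (hybHam D R B g p) (X p) (jT g p)

/-- The Lax pair of the undeformed model. -/
def undefLax (X : ℝ × ℝ → Fin (n + 1) → GroupLieAlgebra 𝓘(ℝ, E) G) (s : ℤˣ) (w : ℂ)
    (p : ℝ × ℝ) : ℂ ⊗[ℝ] GroupLieAlgebra 𝓘(ℝ, E) G :=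
  laxPair D s (pcmCurrent0 D (jX g p) (wzCurrent B g p) (X p)) (pcmCurrent1 D (jX g p)) w

/-- The Lax pair of the deformed model. -/
def hybLax (X : ℝ × ℝ → Fin (n + 1) → GroupLieAlgebra 𝓘(ℝ, E) G) (s : ℤˣ) (w : ℂ)
    (p : ℝ × ℝ) : ℂ ⊗[ℝ] GroupLieAlgebra 𝓘(ℝ, E) G :=
  laxPair D s (hybCurrent0 D (jX g p) (wzCurrent B g p) (X p))
    (hybCurrent1 D (conjR R (g (Fin.last n) p)) (jX g p) (X p)) w

/-- The Hamiltonian `ℋ_hYB = ∑_i ε_i 𝒬_i` at time `t`, space being `S`. -/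
def hybHamiltonian (X : ℝ × ℝ → Fin (n + 1) → GroupLieAlgebra 𝓘(ℝ, E) G) (S : Set ℝ)
    (t : ℝ) : ℝ :=
  ∫ x in S, hybHam D R B g (t, x) (X (t, x))

/-- The action as the inverse Legendre transform
`∑_r ∫∫ κ(X_r, g_r⁻¹ ∂_t g_r) dx dt - ∫ ℋ_hYB dt`, over the window `T × S` of space-time. -/
def hybAction (X : ℝ × ℝ → Fin (n + 1) → GroupLieAlgebra 𝓘(ℝ, E) G) (T S : Set ℝ) : ℝ :=
  (∑ r, ∫ t in T, ∫ x in S, kap (X (t, x) r) (jT g (t, x) r)) -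
    ∫ t in T, hybHamiltonian D R B g X S t

/-- The density `∑_{r,s} κ(j^{(r)}_+, 𝒪_{rs} j^{(s)}_-)`. -/
def hybSigmaDensity (p : ℝ × ℝ) : ℝ :=
  ∑ r, ∑ s, kap (jLC g 1 p r) (opO D (conjR R (g (Fin.last n) p)) r s (jLC g (-1) p s))

/-- The action `∫∫ ∑_{r,s} κ(j^{(r)}_+, 𝒪_{rs} j^{(s)}_-) dx dt + ∑_{r < N} k_r I_WZ[g_r]` over the
window `T × S` of space-time. -/
def hybSigmaAction (T S : Set ℝ) : ℝ :=
  (∫ t in T, ∫ x in S, hybSigmaDensity D R g (t, x)) +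
    ∑ r ∈ Finset.univ.erase (Fin.last n), D.k r * wzTerm (B r) (g r) T S

/-- The currents `j^{(1)}_±, …, j^{(N-1)}_±, J^{(N)}_±`. -/
def hybCurrents (s : ℤˣ) (p : ℝ × ℝ) : Fin (n + 1) → GroupLieAlgebra 𝓘(ℝ, E) G :=
  Function.update (jLC g s p) (Fin.last n)
    (deformedCurrent D (conjR R (g (Fin.last n) p)) s (jLC g s p))

end Fields

end CoupledHYB

end

open CoupledHYB

noncomputable section

/-! Everything reduces to rational functions of the spectral parameter. The twist function is `-ℓ^∞
∏ (w - ζ_i) / ∏ (w - z_q)²`, so `ℒ = Γ / φ` has only simple poles, at the `ζ_i`, and no polynomial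
part. Hence `ℒ_± = ℳ ± ℒ` carries the weights `ε_i ± 1`, and half of its poles disappear. The other
`N` poles lie in `I_±`, so `ℒ_±` is determined by its values at the `N` sites (`inv_sub_zeta`,
`laxPair_eq`). Differentiating the interpolation formula at a site expresses `ℒ_±'(z_q)` through the
values `ℒ_±(z_r)`. The coefficients contain exactly the `ρ_{rs}` and `k_q`
(`ell_mul_deriv_interp_plus`, `ell_mul_deriv_interp_minus`, `siteLax_two`).

The Hamiltonian density is a quadratic form with gradients `ℳ(z_q)` and `ℳ'(z_q)` in the two
currents (`hasDerivAt_hamDensity`). Without deformation the Hamilton equations therefore say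
`ℒ_±(z_r) = j_±^{(r)}`. In the deformed model `X_N` also enters the double pole, and at the last
site the equation becomes `ℒ_±(z_N) = j_±^{(N)} - R_g ℒ_±'(z_N)` (`siteLax_hyb_eq`). Interpolating
the derivative turns this into a linear equation with operator `1 ± ϑ R_g`, solved by `J_±^{(N)}`
(`siteLax_hyb`). The momenta are recovered from the site values, so uniqueness, and by finite
dimension existence, follow.

For the action, the Legendre transform is rewritten site by site as an antisymmetric pairing of
values and derivatives of `ℒ_+` and `ℒ_-` (`kap_site`, `lagrangian_eq_siteLax`). Interpolation
produces `∑ ρ_{rs} κ(ℒ_+(z_r), ℒ_-(z_s))`, and eliminating the derivatives at the last site yields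
`𝒪_{rs}` (`sum_siteLax_eq_sum_opO`).

Invariance of `κ` under `Ad` transfers skew-symmetry and invertibility from `R` to `R_g`. Continuity
of the adjoint action and of the currents gives integrability on compact windows, and Fubini
integrates the pointwise identity. -/

namespace CoupledHYB

/-! ### Factorisation of the twist function, partial fractions and Lagrange interpolation. -/

namespace GaudinData

variable {n : ℕ} (D : GaudinData n)

/-- `∏_{q ≠ r} (w - z_q)`. -/
def prodZ (r : Fin (n + 1)) (w : ℂ) : ℂ := ∏ q ∈ Finset.univ.erase r, (w - D.z q)

/-- `∏_{i ∈ I_±} (w - ζ_i)`. -/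
def prodZeta (s : ℤˣ) (w : ℂ) : ℂ :=
  ∏ i ∈ Finset.univ.filter (fun i => D.eps i = s), (w - D.zeta i)

/-- `1 / φ'(ζ_i)`. -/
def residue (i : Fin (2 * (n + 1))) : ℂ := 1 / deriv D.twist (D.zeta i)

/-- `1 / (ζ_i - z_q)`. -/
def invZ (i : Fin (2 * (n + 1))) (q : Fin (n + 1)) : ℂ := 1 / (D.zeta i - D.z q)

lemma phi_eq (s : ℤˣ) (r : Fin (n + 1)) (w : ℂ) :
    D.phi s r w = D.prodZeta s w / D.prodZ r w := rfl

lemma prodZeta_mul (w : ℂ) : D.prodZeta 1 w * D.prodZeta (-1) w = ∏ i, (w - D.zeta i) := by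
  rw [← Finset.prod_filter_mul_prod_filter_not Finset.univ (fun i => D.eps i = 1)]
  unfold prodZeta
  congr 2
  ext i
  rcases Int.units_eq_one_or (D.eps i) with h | h <;> simp [h]

lemma sub_mul_prodZ (r : Fin (n + 1)) (w : ℂ) :
    (w - D.z r) * D.prodZ r w = ∏ q, (w - D.z q) :=
  Finset.mul_prod_erase Finset.univ (fun q => (w - (D.z q : ℂ))) (Finset.mem_univ r)

lemma prodZ_eq_zero {r q : Fin (n + 1)} (h : q ≠ r) : D.prodZ r (D.z q) = 0 :=
  Finset.prod_eq_zero (Finset.mem_erase.2 ⟨h, Finset.mem_univ q⟩) (sub_self _)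

lemma prodZ_ne_zero_iff {r : Fin (n + 1)} {w : ℂ} :
    D.prodZ r w ≠ 0 ↔ ∀ q, q ≠ r → w ≠ D.z q := by
  simp [prodZ, Finset.prod_ne_zero_iff, sub_ne_zero]

lemma prodZeta_ne_zero {s : ℤˣ} {w : ℂ} (h : ∀ i, w ≠ D.zeta i) : D.prodZeta s w ≠ 0 :=
  Finset.prod_ne_zero_iff.2 fun i _ => sub_ne_zero.2 (h i)

lemma differentiable_prodZ (r : Fin (n + 1)) : Differentiable ℂ (D.prodZ r) := by
  unfold prodZ; fun_prop

lemma differentiable_prodZeta (s : ℤˣ) : Differentiable ℂ (D.prodZeta s) := by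
  unfold prodZeta; fun_prop

lemma eval_nodal_erase (r : Fin (n + 1)) (w : ℂ) :
    (Lagrange.nodal (Finset.univ.erase r) (fun q => (D.z q : ℂ))).eval w = D.prodZ r w :=
  Lagrange.eval_nodal

lemma degree_nodal_erase (r : Fin (n + 1)) :
    (Lagrange.nodal (Finset.univ.erase r) (fun q => (D.z q : ℂ))).degree = (n : ℕ) := by
  rw [Lagrange.degree_nodal]; simp

namespace Admissible

variable {D}

lemma card_filter (hD : D.Admissible) (s : ℤˣ) :
    (Finset.univ.filter fun i => D.eps i = s).card = n + 1 := by
  rcases Int.units_eq_one_or s with rfl | rfl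
  · exact hD.card_plus
  · have h := Finset.card_filter_add_card_filter_not (s := Finset.univ) (fun i => D.eps i = 1)
    rw [hD.card_plus, Finset.card_univ, Fintype.card_fin] at h
    have : (Finset.univ.filter fun i => D.eps i = -1) =
        Finset.univ.filter fun i => ¬ D.eps i = 1 := by
      ext i
      rcases Int.units_eq_one_or (D.eps i) with h | h <;> simp [h]
    rw [this]; omega

lemma zC_injective (hD : D.Admissible) : Function.Injective fun q => (D.z q : ℂ) :=
  Complex.ofReal_injective.comp hD.z_injective

lemma prodZ_self_ne_zero (hD : D.Admissible) (r : Fin (n + 1)) : D.prodZ r (D.z r) ≠ 0 :=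
  D.prodZ_ne_zero_iff.2 fun _ hq h => hq (hD.zC_injective h).symm

lemma z_ne_zeta (hD : D.Admissible) (r : Fin (n + 1)) (i : Fin (2 * (n + 1))) :
    (D.z r : ℂ) ≠ D.zeta i := (hD.zeta_ne i r).symm

lemma phi_self_ne_zero (hD : D.Admissible) (s : ℤˣ) (r : Fin (n + 1)) :
    D.phi s r (D.z r) ≠ 0 :=
  div_ne_zero (D.prodZeta_ne_zero (hD.z_ne_zeta r)) (hD.prodZ_self_ne_zero r)

/-- The numerator of the twist function. -/
lemma twist_numerator (hD : D.Admissible) (w : ℂ) :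
    ∑ r, ((D.ell r : ℂ) - 2 * (D.k r : ℂ) * (w - D.z r)) * D.prodZ r w ^ 2 -
      (D.ellInf : ℂ) * (∏ q, (w - D.z q)) ^ 2 = -(D.ellInf : ℂ) * ∏ i, (w - D.zeta i) := by
  classical
  let zz : Fin (n + 1) → ℂ := fun q => (D.z q : ℂ)
  let p : Polynomial ℂ :=
    ∑ r, ((Polynomial.C (D.ell r : ℂ) - Polynomial.C (2 * (D.k r : ℂ)) *
      (Polynomial.X - Polynomial.C (zz r))) * Lagrange.nodal (Finset.univ.erase r) zz ^ 2) -
      Polynomial.C (D.ellInf : ℂ) *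
        (Lagrange.nodal Finset.univ zz ^ 2 - Lagrange.nodal Finset.univ D.zeta)
  have hev : ∀ w, p.eval w = ∑ r, ((D.ell r : ℂ) - 2 * (D.k r : ℂ) * (w - D.z r)) *
      D.prodZ r w ^ 2 - (D.ellInf : ℂ) * ((∏ q, (w - D.z q)) ^ 2 - ∏ i, (w - D.zeta i)) := by
    intro w
    simp [p, Polynomial.eval_finsetSum, Lagrange.eval_nodal, prodZ, zz]
  -- Grouping the two monic polynomials of degree `2N` cancels their leading terms, so `p` has
  -- degree below `2N` while vanishing at the `2N` distinct zeros.
  have hp : p = 0 := by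
    refine Polynomial.eq_zero_of_degree_lt_of_eval_index_eq_zero (s := Finset.univ)
      (v := D.zeta) hD.zeta_injective.injOn ?_ ?_
    · rw [Finset.card_univ, Fintype.card_fin, ← Polynomial.mem_degreeLT]
      refine Submodule.sub_mem _ (Submodule.sum_mem _ fun r _ => ?_) ?_
      · rw [Polynomial.mem_degreeLT]
        refine (Polynomial.degree_mul_le _ _).trans_lt ?_
        have h1 : (Polynomial.C (D.ell r : ℂ) - Polynomial.C (2 * (D.k r : ℂ)) *
            (Polynomial.X - Polynomial.C (zz r))).degree ≤ 1 := by
          refine (Polynomial.degree_sub_le _ _).trans (max_le ?_ ?_)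
          · exact Polynomial.degree_C_le.trans (by norm_num)
          · refine (Polynomial.degree_mul_le _ _).trans ?_
            rw [Polynomial.degree_X_sub_C]
            calc _ ≤ (0 : WithBot ℕ) + 1 := by gcongr; exact Polynomial.degree_C_le
              _ = 1 := by norm_num
        have h2 : (Lagrange.nodal (Finset.univ.erase r) zz ^ 2).degree =
            ((2 * n : ℕ) : WithBot ℕ) := by
          rw [Polynomial.degree_pow, Lagrange.degree_nodal]
          simp
        rw [h2]
        calc _ ≤ (1 : WithBot ℕ) + ((2 * n : ℕ) : WithBot ℕ) := by gcongr
          _ < _ := by norm_cast; omega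
      · rw [Polynomial.mem_degreeLT]
        refine (Polynomial.degree_mul_le _ _).trans_lt ?_
        have h1 : (Lagrange.nodal Finset.univ zz ^ 2).degree = ((2 * (n + 1) : ℕ) : WithBot ℕ) := by
          rw [Polynomial.degree_pow, Lagrange.degree_nodal, Finset.card_univ, Fintype.card_fin,
            nsmul_eq_mul]
          norm_cast
        have h2 : (Lagrange.nodal Finset.univ zz ^ 2 -
            Lagrange.nodal Finset.univ D.zeta).degree < ((2 * (n + 1) : ℕ) : WithBot ℕ) := by
          rw [← h1]
          refine Polynomial.degree_sub_lt_left ?_ ?_ ?_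
          · rw [h1, Lagrange.degree_nodal]; simp
          · exact pow_ne_zero _ Lagrange.nodal_ne_zero
          · rw [(Lagrange.nodal_monic.pow 2).leadingCoeff, Lagrange.nodal_monic.leadingCoeff]
        calc _ ≤ (0 : WithBot ℕ) + (Lagrange.nodal Finset.univ zz ^ 2 -
            Lagrange.nodal Finset.univ D.zeta).degree := by
              gcongr; exact Polynomial.degree_C_le
          _ < _ := by rw [zero_add]; exact h2
    · intro i _
      rw [hev, Finset.prod_eq_zero (Finset.mem_univ i) (sub_self (D.zeta i)), sub_zero]
      have h := hD.twist_zeta i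
      unfold twist at h
      rw [sub_eq_zero] at h
      rw [← h, Finset.sum_mul, ← Finset.sum_sub_distrib]
      refine Finset.sum_eq_zero fun r _ => ?_
      rw [← D.sub_mul_prodZ r]
      have : D.zeta i - D.z r ≠ 0 := sub_ne_zero.2 (hD.zeta_ne i r)
      field_simp
      ring
  have h := hev w
  rw [hp, Polynomial.eval_zero] at h
  linear_combination -h

lemma twist_eq (hD : D.Admissible) {w : ℂ} (hw : ∀ r, w ≠ D.z r) :
    D.twist w = -(D.ellInf : ℂ) * (∏ i, (w - D.zeta i)) / (∏ q, (w - D.z q)) ^ 2 := by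
  have h0 : (∏ q, (w - (D.z q : ℂ))) ≠ 0 :=
    Finset.prod_ne_zero_iff.2 fun q _ => sub_ne_zero.2 (hw q)
  rw [← hD.twist_numerator w, sub_div, mul_div_cancel_right₀ _ (pow_ne_zero 2 h0), twist,
    Finset.sum_div]
  congr 1
  refine Finset.sum_congr rfl fun r _ => ?_
  have h1 : w - D.z r ≠ 0 := sub_ne_zero.2 (hw r)
  have h2 := D.sub_mul_prodZ r w
  have h3 : D.prodZ r w ≠ 0 := by rintro h; rw [h, mul_zero] at h2; exact h0 h2.symm
  rw [← h2]
  field_simp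

/-- `-ℓ^∞ φ_{+,r} φ_{-,r}` is the regular function `(w - z_r)² φ(w)` near `z_r`. -/
lemma phi_mul_phi (hD : D.Admissible) (r : Fin (n + 1)) {w : ℂ} (hw : D.prodZ r w ≠ 0) :
    -(D.ellInf : ℂ) * (D.phi 1 r w * D.phi (-1) r w) =
      (D.ell r : ℂ) - 2 * (D.k r : ℂ) * (w - D.z r) + (w - D.z r) ^ 2 *
        (∑ q ∈ Finset.univ.erase r, ((D.ell q : ℂ) - 2 * (D.k q : ℂ) * (w - D.z q)) /
          (w - D.z q) ^ 2 - (D.ellInf : ℂ)) := by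
  have h := hD.twist_numerator w
  rw [← D.prodZeta_mul, ← D.sub_mul_prodZ r,
    ← Finset.add_sum_erase _ _ (Finset.mem_univ r)] at h
  have h2 : ∑ q ∈ Finset.univ.erase r, ((D.ell q : ℂ) - 2 * (D.k q : ℂ) * (w - D.z q)) *
      D.prodZ q w ^ 2 = (w - D.z r) ^ 2 * D.prodZ r w ^ 2 * ∑ q ∈ Finset.univ.erase r,
        ((D.ell q : ℂ) - 2 * (D.k q : ℂ) * (w - D.z q)) / (w - D.z q) ^ 2 := by
    rw [Finset.mul_sum]
    refine Finset.sum_congr rfl fun q hq => ?_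
    have hq' : w - D.z q ≠ 0 :=
      sub_ne_zero.2 (D.prodZ_ne_zero_iff.1 hw q (Finset.ne_of_mem_erase hq))
    have : D.prodZ q w = (w - D.z r) * D.prodZ r w / (w - D.z q) := by
      rw [eq_div_iff hq', mul_comm, D.sub_mul_prodZ, D.sub_mul_prodZ]
    rw [this]
    field_simp
  rw [h2] at h
  rw [phi_eq, phi_eq]
  field_simp
  linear_combination -h

lemma hasDerivAt_phi (hD : D.Admissible) (s : ℤˣ) (r : Fin (n + 1)) :
    HasDerivAt (D.phi s r) (deriv (D.phi s r) (D.z r)) (D.z r) :=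
  ((D.differentiable_prodZeta s _).div (D.differentiable_prodZ r _)
    (hD.prodZ_self_ne_zero r)).hasDerivAt

lemma phi_mul_phi_self (hD : D.Admissible) (r : Fin (n + 1)) :
    -(D.ellInf : ℂ) * (D.phi 1 r (D.z r) * D.phi (-1) r (D.z r)) = D.ell r := by
  rw [hD.phi_mul_phi r (hD.prodZ_self_ne_zero r)]; simp

lemma eventually_prodZ_ne_zero (hD : D.Admissible) (r : Fin (n + 1)) :
    ∀ᶠ w in nhds (D.z r : ℂ), D.prodZ r w ≠ 0 :=
  (D.differentiable_prodZ r _).continuousAt.eventually_ne (hD.prodZ_self_ne_zero r)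

/-- The remainder in `phi_mul_phi` carries the factor `(w - z_r)²`, so only the linear term, which
holds the residue of `φ`, contributes. -/
lemma hasDerivAt_phi_mul_phi (hD : D.Admissible) (r : Fin (n + 1)) :
    HasDerivAt (fun w => -(D.ellInf : ℂ) * (D.phi 1 r w * D.phi (-1) r w))
      (-2 * D.k r) (D.z r) := by
  set H : ℂ → ℂ := fun w => ∑ q ∈ Finset.univ.erase r,
    ((D.ell q : ℂ) - 2 * (D.k q : ℂ) * (w - D.z q)) / (w - D.z q) ^ 2 - (D.ellInf : ℂ) with hH
  have hd : DifferentiableAt ℂ H (D.z r) := by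
    refine DifferentiableAt.sub_const ?_ _
    refine DifferentiableAt.fun_sum fun q hq => ?_
    have : ((D.z r : ℂ) - D.z q) ≠ 0 :=
      sub_ne_zero.2 fun h => (Finset.ne_of_mem_erase hq) (hD.zC_injective h).symm
    refine DifferentiableAt.div (by fun_prop) (by fun_prop) (pow_ne_zero 2 this)
  have h1 := ((hasDerivAt_id (D.z r : ℂ)).sub_const (D.z r : ℂ))
  have h2 := (((h1.const_mul (2 * (D.k r : ℂ))).const_sub (D.ell r : ℂ))).add
    ((h1.pow 2).mul hd.hasDerivAt)
  refine (h2.congr_of_eventuallyEq ?_).congr_deriv ?_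
  · filter_upwards [hD.eventually_prodZ_ne_zero r] with w hw
    rw [hD.phi_mul_phi r hw]
    simp [hH]
  · simp

lemma deriv_phi_mul_phi_self (hD : D.Admissible) (r : Fin (n + 1)) :
    (D.ellInf : ℂ) * (deriv (D.phi 1 r) (D.z r) * D.phi (-1) r (D.z r) +
      D.phi 1 r (D.z r) * deriv (D.phi (-1) r) (D.z r)) = 2 * D.k r := by
  have h := (((hD.hasDerivAt_phi 1 r).mul (hD.hasDerivAt_phi (-1) r)).const_mul
    (-(D.ellInf : ℂ))).unique (hD.hasDerivAt_phi_mul_phi r)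
  linear_combination -h

/-- Partial fractions with simple poles at the zeros of the twist function. -/
lemma sum_nodalWeight (hD : D.Admissible) {P : Polynomial ℂ}
    (hP : P ∈ Polynomial.degreeLT ℂ (2 * (n + 1))) {w : ℂ} (hw : ∀ i, w ≠ D.zeta i) :
    ∑ i, Lagrange.nodalWeight Finset.univ D.zeta i * (w - D.zeta i)⁻¹ * P.eval (D.zeta i) =
      P.eval w / ∏ i, (w - D.zeta i) := by
  have h0 : (∏ i, (w - D.zeta i)) ≠ 0 :=
    Finset.prod_ne_zero_iff.2 fun i _ => sub_ne_zero.2 (hw i)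
  have h := Lagrange.eq_interpolate_of_eval_eq (s := Finset.univ) (v := D.zeta)
    (fun i => P.eval (D.zeta i)) (f := P) hD.zeta_injective.injOn
    (by rw [Finset.card_univ, Fintype.card_fin, ← Polynomial.mem_degreeLT]; exact hP)
    (fun _ _ => rfl)
  have h2 := Lagrange.eval_interpolate_not_at_node (s := Finset.univ) (v := D.zeta)
    (fun i => P.eval (D.zeta i)) (x := w) (fun i _ => hw i)
  rw [← h, Lagrange.eval_nodal] at h2
  rw [h2, mul_div_cancel_left₀ _ h0]

lemma hasDerivAt_twist (hD : D.Admissible) (i : Fin (2 * (n + 1))) :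
    HasDerivAt D.twist (-(D.ellInf : ℂ) * (∏ k ∈ Finset.univ.erase i, (D.zeta i - D.zeta k)) /
      (∏ q, (D.zeta i - D.z q)) ^ 2) (D.zeta i) := by
  set c : ℂ → ℂ := fun w => -(D.ellInf : ℂ) * (∏ k ∈ Finset.univ.erase i, (w - D.zeta k)) /
      (∏ q, (w - (D.z q : ℂ))) ^ 2 with hc
  have h0 : (∏ q, (D.zeta i - (D.z q : ℂ))) ≠ 0 :=
    Finset.prod_ne_zero_iff.2 fun q _ => sub_ne_zero.2 (hD.zeta_ne i q)
  have hd : DifferentiableAt ℂ c (D.zeta i) :=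
    DifferentiableAt.div (by fun_prop) (by fun_prop) (pow_ne_zero 2 h0)
  have h1 := ((hasDerivAt_id (D.zeta i)).sub_const (D.zeta i)).mul hd.hasDerivAt
  refine (h1.congr_of_eventuallyEq ?_).congr_deriv (by simp [hc])
  have hz : ∀ᶠ w in nhds (D.zeta i), ∀ q, w ≠ (D.z q : ℂ) :=
    Filter.eventually_all.2 fun q => continuousAt_id.eventually_ne (hD.zeta_ne i q)
  filter_upwards [hz] with w hw
  rw [hD.twist_eq hw, ← Finset.mul_prod_erase Finset.univ (fun k => w - D.zeta k)
    (Finset.mem_univ i)]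
  simp only [Pi.mul_apply, id, hc]
  ring

/-- Turns sums over residues of `1/φ` into barycentric Lagrange sums, where `sum_nodalWeight`
applies. -/
lemma residue_eq (hD : D.Admissible) (i : Fin (2 * (n + 1))) :
    D.residue i = Lagrange.nodalWeight Finset.univ D.zeta i * (∏ q, (D.zeta i - D.z q)) ^ 2 /
      (-(D.ellInf : ℂ)) := by
  rw [residue, (hD.hasDerivAt_twist i).deriv, Lagrange.nodalWeight, Finset.prod_inv_distrib]
  field_simp

/-- The right side is `1 / ((w - z_t)² φ(w))` with the poles of `φ` cleared, so it also makes sense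
at the sites. Interpolation applies because `prodZ t ^ 2` has degree `2N - 2`. -/
lemma sum_residue_sq (hD : D.Admissible) (t : Fin (n + 1)) {w : ℂ} (hw : ∀ i, w ≠ D.zeta i) :
    ∑ i, D.residue i * D.invZ i t ^ 2 / (w - D.zeta i) =
      D.prodZ t w ^ 2 / (-(D.ellInf : ℂ) * ∏ i, (w - D.zeta i)) := by
  have hP : Lagrange.nodal (Finset.univ.erase t) (fun q => (D.z q : ℂ)) ^ 2 ∈
      Polynomial.degreeLT ℂ (2 * (n + 1)) := by
    rw [Polynomial.mem_degreeLT, Polynomial.degree_pow, D.degree_nodal_erase, nsmul_eq_mul]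
    norm_cast; omega
  have h := hD.sum_nodalWeight hP hw
  rw [mul_comm (-(D.ellInf : ℂ)), ← div_div, Polynomial.eval_pow, Lagrange.eval_nodal] at *
  change _ = D.prodZ t w ^ 2 / _ at h
  rw [← h, Finset.sum_div]
  refine Finset.sum_congr rfl fun i _ => ?_
  rw [hD.residue_eq, Polynomial.eval_pow, Lagrange.eval_nodal, ← D.sub_mul_prodZ t, invZ]
  change _ = _ * D.prodZ t (D.zeta i) ^ 2 / _
  have : D.zeta i - D.z t ≠ 0 := sub_ne_zero.2 (hD.zeta_ne i t)
  field_simp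

/-- The same for `1 / ((w - z_t) φ(w))`; the numerator now has degree `2N - 1`, the largest that the
`2N` nodes allow. -/
lemma sum_residue (hD : D.Admissible) (t : Fin (n + 1)) {w : ℂ} (hw : ∀ i, w ≠ D.zeta i) :
    ∑ i, D.residue i * D.invZ i t / (w - D.zeta i) =
      (w - D.z t) * (D.prodZ t w ^ 2 / (-(D.ellInf : ℂ) * ∏ i, (w - D.zeta i))) := by
  have hP : (Polynomial.X - Polynomial.C (D.z t : ℂ)) *
      Lagrange.nodal (Finset.univ.erase t) (fun q => (D.z q : ℂ)) ^ 2 ∈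
      Polynomial.degreeLT ℂ (2 * (n + 1)) := by
    rw [Polynomial.mem_degreeLT, Polynomial.degree_mul, Polynomial.degree_pow,
      D.degree_nodal_erase, Polynomial.degree_X_sub_C, nsmul_eq_mul]
    norm_cast; omega
  have h := hD.sum_nodalWeight hP hw
  rw [mul_comm (-(D.ellInf : ℂ)), ← div_div, ← mul_div_assoc, ← mul_div_assoc]
  rw [Polynomial.eval_mul, Polynomial.eval_pow, Lagrange.eval_nodal, Polynomial.eval_sub,
    Polynomial.eval_X, Polynomial.eval_C] at h
  change _ = (w - D.z t) * D.prodZ t w ^ 2 / _ at h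
  rw [← h, Finset.sum_div]
  refine Finset.sum_congr rfl fun i _ => ?_
  rw [hD.residue_eq, Polynomial.eval_mul, Polynomial.eval_pow, Lagrange.eval_nodal,
    Polynomial.eval_sub, Polynomial.eval_X, Polynomial.eval_C, ← D.sub_mul_prodZ t, invZ]
  change _ = _ * ((D.zeta i - D.z t) * D.prodZ t (D.zeta i) ^ 2) / _
  have : D.zeta i - D.z t ≠ 0 := sub_ne_zero.2 (hD.zeta_ne i t)
  field_simp

/-- Lagrange interpolation of a simple pole at `ζ_i`, `i ∈ I_±`, from its values at the sites. -/
lemma inv_sub_zeta (hD : D.Admissible) {s : ℤˣ} {i : Fin (2 * (n + 1))} (hi : D.eps i = s)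
    {w : ℂ} (hw : ∀ i, w ≠ D.zeta i) :
    1 / (w - D.zeta i) = ∑ r, D.phi s r (D.z r) / D.phi s r w * (1 / (D.z r - D.zeta i)) := by
  classical
  set I := Finset.univ.filter (fun i => D.eps i = s) with hI
  have hiI : i ∈ I := by simp [hI, hi]
  -- After multiplication by `prodZeta s`, the pole becomes a polynomial of degree `N - 1`, since
  -- `I_±` has `N` elements. The `N` sites determine it, and `Q` is its Lagrange interpolant there.
  let P : Polynomial ℂ := Lagrange.nodal (I.erase i) D.zeta
  let zz : Fin (n + 1) → ℂ := fun q => (D.z q : ℂ)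
  let Q : Polynomial ℂ := ∑ r, Polynomial.C (P.eval (zz r) / D.prodZ r (zz r)) *
    Lagrange.nodal (Finset.univ.erase r) zz
  have hPQ : P = Q := by
    refine Polynomial.eq_of_degrees_lt_of_eval_index_eq (s := Finset.univ) (v := zz)
      hD.zC_injective.injOn ?_ ?_ ?_
    · rw [Lagrange.degree_nodal, Finset.card_erase_of_mem hiI, hI, hD.card_filter s,
        Finset.card_univ, Fintype.card_fin]
      norm_cast; omega
    · rw [Finset.card_univ, Fintype.card_fin, ← Polynomial.mem_degreeLT]
      refine Submodule.sum_mem _ fun r _ => ?_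
      rw [← Polynomial.smul_eq_C_mul]
      refine Submodule.smul_mem _ _ ?_
      rw [Polynomial.mem_degreeLT, D.degree_nodal_erase]
      norm_cast; omega
    · intro q _
      rw [Polynomial.eval_finsetSum, Finset.sum_eq_single q]
      · rw [Polynomial.eval_mul, Polynomial.eval_C, D.eval_nodal_erase]
        exact (div_mul_cancel₀ _ (hD.prodZ_self_ne_zero q)).symm
      · intro r _ hr
        rw [Polynomial.eval_mul, D.eval_nodal_erase]
        exact mul_eq_zero_of_right _ (D.prodZ_eq_zero hr.symm)
      · simp
  have hPe : ∀ x, (x - D.zeta i) * P.eval x = D.prodZeta s x := by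
    intro x
    rw [Lagrange.eval_nodal]
    exact Finset.mul_prod_erase I (fun k => x - D.zeta k) hiI
  have h := congrArg (Polynomial.eval w) hPQ
  rw [Polynomial.eval_finsetSum] at h
  have hw' := sub_ne_zero.2 (hw i)
  have h1 : P.eval w = D.prodZeta s w * (1 / (w - D.zeta i)) := by
    rw [← hPe]; field_simp
  rw [← mul_right_inj' (D.prodZeta_ne_zero (s := s) hw), ← h1, h, Finset.mul_sum]
  refine Finset.sum_congr rfl fun r _ => ?_
  have h2 : P.eval (zz r) = D.prodZeta s (zz r) * (1 / (zz r - D.zeta i)) := by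
    have := sub_ne_zero.2 (hD.z_ne_zeta r i)
    rw [← hPe]; simp only [zz]; field_simp
  rw [Polynomial.eval_mul, Polynomial.eval_C, h2, Lagrange.eval_nodal]
  change _ / _ * D.prodZ r w = _
  rw [phi_eq, phi_eq, div_div_eq_mul_div]
  have := D.prodZeta_ne_zero (s := s) hw
  simp only [zz]
  field_simp

end Admissible

end GaudinData

/-! ### Moments of the residues, derivatives of the interpolation functions, and reality. -/

namespace GaudinData

variable {n : ℕ} (D : GaudinData n)

/-- `-∑_i c_i / φ'(ζ_i) / ((ζ_i - z_q)^b (ζ_i - z_t)^a)`. -/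
def moment (c : Fin (2 * (n + 1)) → ℂ) (b a : ℕ) (q t : Fin (n + 1)) : ℂ :=
  -∑ i, c i * D.residue i * D.invZ i q ^ b * D.invZ i t ^ a

lemma moment_comm (c : Fin (2 * (n + 1)) → ℂ) (b a : ℕ) (q t : Fin (n + 1)) :
    D.moment c b a q t = D.moment c a b t q := by
  unfold moment
  congr 1
  exact Finset.sum_congr rfl fun i _ => by ring

/-- The coefficient of the value at `z_r` in the interpolation of the Lax pair. -/
def interp (s : ℤˣ) (r : Fin (n + 1)) (w : ℂ) : ℂ := D.phi s r (D.z r) / D.phi s r w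

lemma interp_eq (s : ℤˣ) (r : Fin (n + 1)) (w : ℂ) :
    D.interp s r w = D.phi s r (D.z r) * D.prodZ r w / D.prodZeta s w := by
  rw [interp, phi_eq D s r w, div_div_eq_mul_div]

lemma invZ_eq (i : Fin (2 * (n + 1))) (q : Fin (n + 1)) :
    1 / ((D.z q : ℂ) - D.zeta i) = -D.invZ i q := by
  rw [invZ, ← neg_sub, div_neg]

namespace Admissible

variable {D}

lemma hasDerivAt_sum_poles (c : Fin (2 * (n + 1)) → ℂ) {w : ℂ} (hw : ∀ i, w ≠ D.zeta i) :
    HasDerivAt (fun w => ∑ i, c i / (w - D.zeta i)) (-∑ i, c i / (w - D.zeta i) ^ 2) w := by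
  rw [← Finset.sum_neg_distrib]
  refine HasDerivAt.fun_sum fun i _ => ?_
  have h := ((hasDerivAt_id w).sub_const (D.zeta i)).fun_inv (sub_ne_zero.2 (hw i))
  refine ((h.const_mul (c i)).congr_deriv ?_)
  simp only [id]
  ring

/-- This fixes the meaning of the exponents: `b = 1` is the value at `z_q` of a sum of poles and `b
= 2` its derivative there, while `a = 1, 2` selects the contribution of the simple or double pole of
`Γ` at `z_t`. -/
lemma sum_poles_one (c : Fin (2 * (n + 1)) → ℂ) (a : ℕ) (q t : Fin (n + 1)) :
    ∑ i, c i * D.residue i * D.invZ i t ^ a / (D.z q - D.zeta i) = D.moment c 1 a q t := by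
  rw [moment, ← Finset.sum_neg_distrib]
  refine Finset.sum_congr rfl fun i _ => ?_
  rw [div_eq_mul_one_div, invZ_eq]; ring

lemma sum_poles_two (c : Fin (2 * (n + 1)) → ℂ) (a : ℕ) (q t : Fin (n + 1)) :
    -∑ i, c i * D.residue i * D.invZ i t ^ a / (D.z q - D.zeta i) ^ 2 = D.moment c 2 a q t := by
  rw [moment]
  congr 1
  refine Finset.sum_congr rfl fun i _ => ?_
  rw [div_eq_mul_one_div, ← one_div_pow, invZ_eq]; ring

/-- The double pole of `φ` makes `1 / ((w - z_t) φ(w))` vanish at every site, even at `z_t`. -/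
lemma moment_one_one (hD : D.Admissible) (q t : Fin (n + 1)) : D.moment 1 1 1 q t = 0 := by
  rw [← sum_poles_one]
  simp only [Pi.one_apply, one_mul, pow_one]
  rw [hD.sum_residue t (hD.z_ne_zeta q)]
  rcases eq_or_ne q t with rfl | h
  · simp
  · simp [D.prodZ_eq_zero h]

lemma inv_phi_mul_phi (t : Fin (n + 1)) {w : ℂ} :
    D.prodZ t w ^ 2 / (-(D.ellInf : ℂ) * ∏ i, (w - D.zeta i)) =
      (-(D.ellInf : ℂ) * (D.phi 1 t w * D.phi (-1) t w))⁻¹ := by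
  rw [← D.prodZeta_mul, phi_eq, phi_eq, div_mul_div_comm, mul_div_assoc', inv_div, sq]

/-- At `z_t` the function `1 / ((w - z_t)² φ(w))` takes the value `1 / ℓ_t`; at the other sites the
double pole of `φ` kills it. -/
lemma moment_one_two (hD : D.Admissible) (q t : Fin (n + 1)) :
    D.moment 1 1 2 q t = if q = t then 1 / (D.ell q : ℂ) else 0 := by
  rw [← sum_poles_one]
  simp only [Pi.one_apply, one_mul]
  rw [hD.sum_residue_sq t (hD.z_ne_zeta q), inv_phi_mul_phi]
  split_ifs with h
  · subst h
    rw [hD.phi_mul_phi_self, one_div]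
  · rw [← inv_phi_mul_phi, D.prodZ_eq_zero h]
    simp

lemma moment_two_one (hD : D.Admissible) (q t : Fin (n + 1)) :
    D.moment 1 2 1 q t = if q = t then 1 / (D.ell q : ℂ) else 0 := by
  rw [moment_comm, hD.moment_one_two]
  rcases eq_or_ne q t with rfl | h
  · simp
  · simp [h, h.symm]

lemma eventually_ne_zeta (hD : D.Admissible) (q : Fin (n + 1)) :
    ∀ᶠ w in nhds (D.z q : ℂ), ∀ i, w ≠ D.zeta i :=
  Filter.eventually_all.2 fun i => continuousAt_id.eventually_ne (hD.z_ne_zeta q i)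

/-- For `q = t` this is the derivative of the inverse of `ℓ_q - 2 k_q (w - z_q) + O((w - z_q)²)`;
for `q ≠ t` the zero is double. -/
lemma moment_two_two (hD : D.Admissible) (q t : Fin (n + 1)) :
    D.moment 1 2 2 q t = if q = t then 2 * (D.k q : ℂ) / (D.ell q : ℂ) ^ 2 else 0 := by
  rw [← sum_poles_two]
  have h1 := hasDerivAt_sum_poles (D := D) (fun i => (1 : Fin (2 * (n + 1)) → ℂ) i * D.residue i *
    D.invZ i t ^ 2) (hD.z_ne_zeta q)
  refine (h1.congr_of_eventuallyEq (f₁ := fun w => D.prodZ t w ^ 2 /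
    (-(D.ellInf : ℂ) * ∏ i, (w - D.zeta i))) ?_).unique ?_
  · filter_upwards [hD.eventually_ne_zeta q] with w hw
    simp only [Pi.one_apply, one_mul]
    exact (hD.sum_residue_sq t hw).symm
  · split_ifs with h
    · subst h
      simp_rw [inv_phi_mul_phi]
      have hl : (D.ell q : ℂ) ≠ 0 := by exact_mod_cast hD.ell_ne_zero q
      have h2 := (hD.hasDerivAt_phi_mul_phi q).fun_inv (by rw [hD.phi_mul_phi_self]; exact hl)
      refine h2.congr_deriv ?_
      rw [hD.phi_mul_phi_self]
      ring
    · have hd : DifferentiableAt ℂ (fun w => (-(D.ellInf : ℂ) * ∏ i, (w - D.zeta i))⁻¹)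
          (D.z q) := by
        refine DifferentiableAt.fun_inv (by fun_prop) (mul_ne_zero ?_ ?_)
        · simpa using hD.ellInf_ne_zero
        · exact Finset.prod_ne_zero_iff.2 fun i _ => sub_ne_zero.2 (hD.z_ne_zeta q i)
      have h2 := ((D.differentiable_prodZ t (D.z q)).hasDerivAt.fun_pow 2).fun_mul hd.hasDerivAt
      simp_rw [div_eq_mul_inv]
      refine h2.congr_deriv ?_
      simp [D.prodZ_eq_zero h]

lemma sum_poles_interp (hD : D.Admissible) (s : ℤˣ) (c : Fin (2 * (n + 1)) → ℂ)
    (hc : ∀ i, D.eps i ≠ s → c i = 0) {w : ℂ} (hw : ∀ i, w ≠ D.zeta i) :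
    ∑ i, c i / (w - D.zeta i) =
      ∑ r, D.interp s r w * ∑ i, c i / (D.z r - D.zeta i) := by
  simp_rw [Finset.mul_sum]
  rw [Finset.sum_comm]
  refine Finset.sum_congr rfl fun i _ => ?_
  rcases eq_or_ne (D.eps i) s with h | h
  · rw [div_eq_mul_one_div, hD.inv_sub_zeta h hw, Finset.mul_sum]
    refine Finset.sum_congr rfl fun r _ => ?_
    rw [interp]; ring
  · simp [hc i h]

lemma sum_poles_deriv_interp (hD : D.Admissible) (s : ℤˣ) (c : Fin (2 * (n + 1)) → ℂ)
    (hc : ∀ i, D.eps i ≠ s → c i = 0) (q : Fin (n + 1)) :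
    -∑ i, c i / (D.z q - D.zeta i) ^ 2 =
      ∑ r, deriv (D.interp s r) (D.z q) * ∑ i, c i / (D.z r - D.zeta i) := by
  refine (hasDerivAt_sum_poles c (hD.z_ne_zeta q)).unique ?_
  have h : HasDerivAt (fun w => ∑ r, D.interp s r w * ∑ i, c i / (D.z r - D.zeta i))
      (∑ r, deriv (D.interp s r) (D.z q) * ∑ i, c i / (D.z r - D.zeta i)) (D.z q) := by
    refine HasDerivAt.fun_sum fun r _ => HasDerivAt.mul_const ?_ _
    refine DifferentiableAt.hasDerivAt ?_
    have : D.interp s r = fun w => D.phi s r (D.z r) * D.prodZ r w / D.prodZeta s w :=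
      funext fun w => D.interp_eq s r w
    rw [this]
    exact ((D.differentiable_prodZ r _).const_mul _).div (D.differentiable_prodZeta s _)
      (D.prodZeta_ne_zero (hD.z_ne_zeta q))
  refine h.congr_of_eventuallyEq ?_
  filter_upwards [hD.eventually_ne_zeta q] with w hw
  exact hD.sum_poles_interp s c hc hw

lemma deriv_interp_self (hD : D.Admissible) (s : ℤˣ) (q : Fin (n + 1)) :
    deriv (D.interp s q) (D.z q) = -deriv (D.phi s q) (D.z q) / D.phi s q (D.z q) := by
  have h := (((hD.hasDerivAt_phi s q).fun_inv (hD.phi_self_ne_zero s q)).const_mul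
    (D.phi s q (D.z q)))
  have h2 : D.interp s q = fun w => D.phi s q (D.z q) * (D.phi s q w)⁻¹ := rfl
  rw [h2, h.deriv]
  have := hD.phi_self_ne_zero s q
  field_simp

/-- `interp s r` has a simple zero at every site `z_q` with `q ≠ r`, so its derivative there is the
cofactor of `w - z_q`. -/
lemma deriv_interp_ne (hD : D.Admissible) (s : ℤˣ) {q r : Fin (n + 1)} (hqr : q ≠ r) :
    deriv (D.interp s r) (D.z q) =
      D.phi s r (D.z r) / (D.phi s q (D.z q) * (D.z q - D.z r)) := by
  have hz : ∀ᶠ w : ℂ in nhds (D.z q : ℂ), w ≠ D.z r :=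
    continuousAt_id.eventually_ne fun h => hqr (hD.zC_injective h)
  have hne : (D.z q : ℂ) - D.z r ≠ 0 := sub_ne_zero.2 fun h => hqr (hD.zC_injective h)
  have hd : DifferentiableAt ℂ (fun w => D.phi s r (D.z r) * D.prodZ q w /
      (D.prodZeta s w * (w - D.z r))) (D.z q) :=
    ((D.differentiable_prodZ q _).const_mul _).div
      ((D.differentiable_prodZeta s _).mul (by fun_prop))
      (mul_ne_zero (D.prodZeta_ne_zero (hD.z_ne_zeta q)) hne)
  have h := ((hasDerivAt_id (D.z q : ℂ)).sub_const (D.z q : ℂ)).mul hd.hasDerivAt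
  have h2 : D.interp s r =ᶠ[nhds (D.z q : ℂ)] ((fun w => id w - (D.z q : ℂ)) *
      fun w => D.phi s r (D.z r) * D.prodZ q w / (D.prodZeta s w * (w - D.z r))) := by
    filter_upwards [hz] with w hw
    have hw' := sub_ne_zero.2 hw
    have h3 := (D.sub_mul_prodZ r w).trans (D.sub_mul_prodZ q w).symm
    rw [interp_eq]
    simp only [Pi.mul_apply, id]
    have h4 : D.prodZ r w = (w - D.z q) * D.prodZ q w / (w - D.z r) := by
      rw [eq_div_iff hw', ← h3, mul_comm]
    rw [h4]
    field_simp
  rw [(h.congr_of_eventuallyEq h2).deriv]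
  have h4 := hD.prodZ_self_ne_zero q
  have h5 := D.prodZeta_ne_zero (s := s) (hD.z_ne_zeta q)
  simp only [id, sub_self, zero_mul, add_zero, one_mul, phi_eq D s q]
  field_simp

/-- This is where the `ρ_{rs}` originate. On the diagonal, `ℓ^∞ φ_+' φ_-` splits into its
antisymmetric part `2 ρ_{qq}` and its symmetric part `k_q`. For the minus sign the indices of `ρ`
are exchanged. -/
lemma ell_mul_deriv_interp_plus (hD : D.Admissible) (q r : Fin (n + 1)) :
    (D.ell q : ℂ) * deriv (D.interp 1 r) (D.z q) =
      2 * D.rhoC r q + if r = q then (D.k q : ℂ) else 0 := by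
  have h1 := hD.phi_mul_phi_self q
  have h2 := hD.deriv_phi_mul_phi_self q
  have h3 := hD.phi_self_ne_zero 1 q
  rw [rhoC]
  split_ifs with h
  · subst h
    rw [hD.deriv_interp_self, ← h1]
    field_simp
    linear_combination 2 * h2
  · have hne : (D.z q : ℂ) - D.z r ≠ 0 := sub_ne_zero.2 fun h' => h (hD.zC_injective h').symm
    have hne' : (D.z r : ℂ) - D.z q ≠ 0 := sub_ne_zero.2 fun h' => h (hD.zC_injective h')
    rw [hD.deriv_interp_ne 1 (Ne.symm h), ← h1]
    field_simp
    ring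

lemma ell_mul_deriv_interp_minus (hD : D.Admissible) (q r : Fin (n + 1)) :
    (D.ell q : ℂ) * deriv (D.interp (-1) r) (D.z q) =
      -(2 * D.rhoC q r) + if r = q then (D.k q : ℂ) else 0 := by
  have h1 := hD.phi_mul_phi_self q
  have h2 := hD.deriv_phi_mul_phi_self q
  have h3 := hD.phi_self_ne_zero (-1) q
  rw [rhoC]
  rcases eq_or_ne r q with h | h
  · subst h
    rw [hD.deriv_interp_self, ← h1, if_pos rfl, if_pos rfl]
    field_simp
    linear_combination 2 * h2
  · have hne : (D.z q : ℂ) - D.z r ≠ 0 := sub_ne_zero.2 fun h' => h (hD.zC_injective h').symm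
    rw [hD.deriv_interp_ne (-1) h.symm, ← h1, if_neg h.symm, if_neg h]
    field_simp
    ring

/-! #### Reality -/

/-- Source of all reality statements: complex conjugation only reindexes sums and products over the
zeros, without mixing the two signs. -/
lemma exists_conj_perm (hD : D.Admissible) : ∃ σ : Equiv.Perm (Fin (2 * (n + 1))),
    ∀ i, D.zeta (σ i) = (starRingEnd ℂ) (D.zeta i) ∧ D.eps (σ i) = D.eps i := by
  choose f hf using hD.conj_zeta
  have hinj : Function.Injective f := by
    intro i j hij
    have := (hf i).1.symm.trans ((congrArg D.zeta hij).trans (hf j).1)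
    exact hD.zeta_injective ((starRingEnd ℂ).injective this)
  exact ⟨Equiv.ofBijective f (Finite.injective_iff_bijective.1 hinj), hf⟩

lemma conj_prodZ (r : Fin (n + 1)) (w : ℂ) :
    (starRingEnd ℂ) (D.prodZ r w) = D.prodZ r ((starRingEnd ℂ) w) := by
  simp [prodZ]

lemma conj_prodZeta (hD : D.Admissible) (s : ℤˣ) (w : ℂ) :
    (starRingEnd ℂ) (D.prodZeta s w) = D.prodZeta s ((starRingEnd ℂ) w) := by
  obtain ⟨σ, hσ⟩ := hD.exists_conj_perm
  rw [prodZeta, map_prod, prodZeta]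
  refine Finset.prod_equiv σ (fun i => ?_) fun i _ => ?_
  · simp [(hσ i).2]
  · rw [(hσ i).1, map_sub]

lemma conj_phi (hD : D.Admissible) (s : ℤˣ) (r : Fin (n + 1)) (w : ℂ) :
    (starRingEnd ℂ) (D.phi s r w) = D.phi s r ((starRingEnd ℂ) w) := by
  rw [phi_eq, phi_eq, map_div₀, hD.conj_prodZeta, conj_prodZ]

lemma conj_deriv {f : ℂ → ℂ} (hf : ∀ w, (starRingEnd ℂ) (f w) = f ((starRingEnd ℂ) w)) (w : ℂ) :
    (starRingEnd ℂ) (deriv f w) = deriv f ((starRingEnd ℂ) w) := by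
  have h : (starRingEnd ℂ) ∘ f ∘ (starRingEnd ℂ) = f := by
    funext x; simp [hf]
  have h2 := congrFun (deriv_conj_conj (𝕜 := ℂ) (f := f)) ((starRingEnd ℂ) w)
  rw [h] at h2
  rw [h2]; simp

lemma conj_twist (w : ℂ) : (starRingEnd ℂ) (D.twist w) = D.twist ((starRingEnd ℂ) w) := by
  simp [twist, map_ofNat]

lemma ofReal_rho (hD : D.Admissible) (r s : Fin (n + 1)) : (D.rho r s : ℂ) = D.rhoC r s := by
  rw [rho, ← Complex.conj_eq_iff_re, rhoC]
  split_ifs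
  · simp [hD.conj_phi, conj_deriv (hD.conj_phi _ _), map_ofNat]
  · simp [hD.conj_phi, map_ofNat]

lemma ofReal_moment_re (hD : D.Admissible) (b a : ℕ) (q t : Fin (n + 1)) :
    ((D.moment (fun i => sgn (D.eps i)) b a q t).re : ℂ) =
      D.moment (fun i => sgn (D.eps i)) b a q t := by
  obtain ⟨σ, hσ⟩ := hD.exists_conj_perm
  rw [← Complex.conj_eq_iff_re, moment, map_neg, map_sum]
  congr 1
  refine Fintype.sum_equiv σ _ _ fun i => ?_
  simp [residue, invZ, hσ, conj_deriv conj_twist]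

end Admissible

end GaudinData

/-! ### Derivatives of `ℒ_±` at the sites in terms of its values. -/

namespace GaudinData

variable {n : ℕ} (D : GaudinData n)

/-- The real coefficients of `(ℳ ± ℒ)'(z_q)` in the values `(ℳ ± ℒ)(z_r)`. -/
def derivCoeff (s : ℤˣ) (q r : Fin (n + 1)) : ℝ :=
  ((if s = 1 then 2 * D.rho r q else -(2 * D.rho q r)) + if r = q then D.k q else 0) / D.ell q

/-- The weights `ε_i ± 1`. -/
def laxWeight (s : ℤˣ) (i : Fin (2 * (n + 1))) : ℂ := sgn (D.eps i) + sgn s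

/-- Half of the poles drop out of `ℒ_±`, which is what makes `N` sites enough to interpolate it. -/
lemma laxWeight_eq_zero {s : ℤˣ} {i : Fin (2 * (n + 1))} (h : D.eps i ≠ s) :
    D.laxWeight s i = 0 := by
  rw [laxWeight]
  rcases Int.units_eq_one_or (D.eps i) with h1 | h1 <;>
    rcases Int.units_eq_one_or s with h2 | h2 <;> simp_all [sgn]

lemma moment_laxWeight (s : ℤˣ) (b a : ℕ) (q t : Fin (n + 1)) :
    D.moment (D.laxWeight s) b a q t =
      D.moment (fun i => sgn (D.eps i)) b a q t + sgn s * D.moment 1 b a q t := by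
  simp only [moment, laxWeight, Pi.one_apply, mul_neg, Finset.mul_sum]
  rw [← neg_add, ← Finset.sum_add_distrib]
  congr 1
  exact Finset.sum_congr rfl fun i _ => by ring

namespace Admissible

variable {D}

lemma ofReal_derivCoeff (hD : D.Admissible) (s : ℤˣ) (q r : Fin (n + 1)) :
    (D.derivCoeff s q r : ℂ) = deriv (D.interp s r) (D.z q) := by
  have hl : (D.ell q : ℂ) ≠ 0 := by exact_mod_cast hD.ell_ne_zero q
  rw [← mul_right_inj' hl]
  rcases Int.units_eq_one_or s with rfl | rfl
  · rw [hD.ell_mul_deriv_interp_plus, derivCoeff, ← hD.ofReal_rho]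
    push_cast
    rw [mul_div_cancel₀ _ hl, if_pos rfl]
    split_ifs <;> simp
  · rw [hD.ell_mul_deriv_interp_minus, derivCoeff, ← hD.ofReal_rho]
    push_cast
    rw [mul_div_cancel₀ _ hl, if_neg (by decide)]
    split_ifs <;> simp

lemma derivCoeff_last (hk : D.k (Fin.last n) = 0) (s : ℤˣ) :
    D.derivCoeff s (Fin.last n) (Fin.last n) = sgn s * D.theta := by
  rcases Int.units_eq_one_or s with rfl | rfl <;> simp [derivCoeff, theta, hk, sgn]
  all_goals ring

lemma moment_two_eq (hD : D.Admissible) (s : ℤˣ) (a : ℕ) (q t : Fin (n + 1)) :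
    D.moment (D.laxWeight s) 2 a q t =
      ∑ r, (D.derivCoeff s q r : ℂ) * D.moment (D.laxWeight s) 1 a r t := by
  rw [← sum_poles_two, hD.sum_poles_deriv_interp s]
  · refine Finset.sum_congr rfl fun r _ => ?_
    rw [sum_poles_one, hD.ofReal_derivCoeff]
  · intro i hi
    simp [D.laxWeight_eq_zero hi]

lemma moment_two_re (hD : D.Admissible) (s : ℤˣ) (a : ℕ) (q t : Fin (n + 1)) :
    (D.moment (D.laxWeight s) 2 a q t).re =
      ∑ r, D.derivCoeff s q r * (D.moment (D.laxWeight s) 1 a r t).re := by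
  rw [hD.moment_two_eq, Complex.re_sum]
  simp

lemma ofReal_moment_laxWeight_re (hD : D.Admissible) (s : ℤˣ) (a : ℕ) (ha : a = 1 ∨ a = 2)
    (q t : Fin (n + 1)) :
    ((D.moment (D.laxWeight s) 1 a q t).re : ℂ) = D.moment (D.laxWeight s) 1 a q t := by
  have h1 := hD.ofReal_moment_re 1 a q t
  have h2 : ((D.moment 1 1 a q t).re : ℂ) = D.moment 1 1 a q t := by
    rcases ha with rfl | rfl
    · simp [hD.moment_one_one]
    · rw [hD.moment_one_two]; split_ifs <;> simp [← Complex.ofReal_inv]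
  rw [moment_laxWeight, ← h1, ← h2]
  simp

end Admissible

end GaudinData

/-! ### The Lax pair and the Hamiltonian density through values at the sites. -/

section Algebra

variable {L : Type*} [LieRing L] [LieAlgebra ℝ L] {n : ℕ} (D : GaudinData n)

lemma kap_comm (x y : L) : kap x y = kap y x := by
  simp only [kap, LinearMap.neg_apply]
  rw [LieModule.traceForm_comm]

lemma kapC_tmul [Module.Finite ℝ L] (a b : ℂ) (x y : L) :
    kapC (a ⊗ₜ[ℝ] x) (b ⊗ₜ[ℝ] y) = a * b * (kap x y : ℝ) := by
  simp only [kap, kapC, LinearMap.neg_apply]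
  rw [killingForm, LieModule.traceForm_baseChange]
  rw [LinearMap.BilinForm.baseChange_tmul]
  simp [mul_comm]

/-- `∑_t (m_{b1} 𝒥_{(t),[0]} + m_{b2} 𝒥_{(t),[1]})` for the moments of the weights `c`. -/
def laxSum (c : Fin (2 * (n + 1)) → ℂ) (b : ℕ) (A0 A1 : Fin (n + 1) → L) (q : Fin (n + 1)) : L :=
  ∑ t, ((D.moment c b 1 q t).re • A0 t + (D.moment c b 2 q t).re • A1 t)

/-- `ℳ(z_q)` for `b = 1`, `ℳ'(z_q)` for `b = 2`. -/
def siteM (b : ℕ) (A0 A1 : Fin (n + 1) → L) (q : Fin (n + 1)) : L :=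
  laxSum D (fun i => sgn (D.eps i)) b A0 A1 q

/-- `ℒ_±(z_q)` for `b = 1`, `ℒ_±'(z_q)` for `b = 2`. -/
def siteLax (s : ℤˣ) (b : ℕ) (A0 A1 : Fin (n + 1) → L) (q : Fin (n + 1)) : L :=
  laxSum D (D.laxWeight s) b A0 A1 q

variable {D}

lemma laxSum_add (c : Fin (2 * (n + 1)) → ℂ) (b : ℕ) (A0 A1 B0 B1 : Fin (n + 1) → L)
    (q : Fin (n + 1)) :
    laxSum D c b (A0 + B0) (A1 + B1) q = laxSum D c b A0 A1 q + laxSum D c b B0 B1 q := by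
  simp only [laxSum, Pi.add_apply, smul_add, ← Finset.sum_add_distrib]
  exact Finset.sum_congr rfl fun t _ => by abel

lemma laxSum_smul (c : Fin (2 * (n + 1)) → ℂ) (b : ℕ) (a : ℝ) (A0 A1 : Fin (n + 1) → L)
    (q : Fin (n + 1)) :
    laxSum D c b (a • A0) (a • A1) q = a • laxSum D c b A0 A1 q := by
  simp only [laxSum, Pi.smul_apply, Finset.smul_sum, smul_add]
  refine Finset.sum_congr rfl fun t _ => ?_
  rw [smul_comm a, smul_comm a]

/-- With weights `1` the sum is `ℒ(z_q)`: near `z_q` only the ratio of the double poles of `Γ` and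
`φ` survives. -/
lemma laxSum_one_one (hD : D.Admissible) (A0 A1 : Fin (n + 1) → L) (q : Fin (n + 1)) :
    laxSum D 1 1 A0 A1 q = (1 / D.ell q) • A1 q := by
  rw [laxSum, Finset.sum_eq_single q]
  · rw [hD.moment_one_one, hD.moment_one_two]
    simp [← Complex.ofReal_inv]
  · intro t _ h
    rw [hD.moment_one_one, hD.moment_one_two]
    simp [h.symm]
  · simp

lemma laxSum_one_two (hD : D.Admissible) (A0 A1 : Fin (n + 1) → L) (q : Fin (n + 1)) :
    laxSum D 1 2 A0 A1 q = (1 / D.ell q) • A0 q + (2 * D.k q / D.ell q ^ 2) • A1 q := by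
  have h2 : (2 * (D.k q : ℂ) / (D.ell q : ℂ) ^ 2).re = 2 * D.k q / D.ell q ^ 2 := by
    rw [← Complex.ofReal_re (2 * D.k q / D.ell q ^ 2)]
    push_cast
    rfl
  rw [laxSum, Finset.sum_eq_single q]
  · rw [hD.moment_two_one, hD.moment_two_two, if_pos rfl, if_pos rfl, h2]
    simp [← Complex.ofReal_inv]
  · intro t _ h
    rw [hD.moment_two_one, hD.moment_two_two]
    simp [h.symm]
  · simp

lemma siteLax_eq (s : ℤˣ) (b : ℕ) (A0 A1 : Fin (n + 1) → L) (q : Fin (n + 1)) :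
    siteLax D s b A0 A1 q = siteM D b A0 A1 q + sgn s • laxSum D 1 b A0 A1 q := by
  simp only [siteLax, siteM, laxSum, Finset.smul_sum, ← Finset.sum_add_distrib,
    D.moment_laxWeight]
  refine Finset.sum_congr rfl fun t _ => ?_
  simp only [Complex.add_re, Complex.re_ofReal_mul]
  module

lemma siteLax_one_eq (hD : D.Admissible) (s : ℤˣ) (A0 A1 : Fin (n + 1) → L) (q : Fin (n + 1)) :
    siteLax D s 1 A0 A1 q = siteM D 1 A0 A1 q + sgn s • (1 / D.ell q) • A1 q := by
  rw [siteLax_eq, laxSum_one_one hD]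

lemma siteLax_two_eq (hD : D.Admissible) (s : ℤˣ) (A0 A1 : Fin (n + 1) → L) (q : Fin (n + 1)) :
    siteLax D s 2 A0 A1 q = siteM D 2 A0 A1 q +
      sgn s • ((1 / D.ell q) • A0 q + (2 * D.k q / D.ell q ^ 2) • A1 q) := by
  rw [siteLax_eq, laxSum_one_two hD]

/-- The derivative of the Lax pair at a site, by Lagrange interpolation. -/
lemma siteLax_two (hD : D.Admissible) (s : ℤˣ) (A0 A1 : Fin (n + 1) → L) (q : Fin (n + 1)) :
    siteLax D s 2 A0 A1 q = ∑ r, D.derivCoeff s q r • siteLax D s 1 A0 A1 r := by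
  simp only [siteLax, laxSum, hD.moment_two_re, Finset.smul_sum, Finset.sum_smul, smul_add,
    smul_smul, ← Finset.sum_add_distrib]
  rw [Finset.sum_comm]

lemma sum_smul_gaudinLax (c : Fin (2 * (n + 1)) → ℂ) (A0 A1 : Fin (n + 1) → L) :
    ∑ i, c i • gaudinLax D A0 A1 (D.zeta i) =
      ∑ t, ((∑ i, c i * D.invZ i t ^ 2) ⊗ₜ[ℝ] A1 t + (∑ i, c i * D.invZ i t) ⊗ₜ[ℝ] A0 t) := by
  simp only [gaudinLax, Finset.smul_sum, smul_add, TensorProduct.smul_tmul', TensorProduct.sum_tmul,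
    ← Finset.sum_add_distrib]
  rw [Finset.sum_comm]
  simp [GaudinData.invZ]

/-- Partial fraction expansion of `ℒ = Γ / φ`. -/
lemma laxL_eq (hD : D.Admissible) (A0 A1 : Fin (n + 1) → L) {w : ℂ} (hz : ∀ r, w ≠ D.z r)
    (hw : ∀ i, w ≠ D.zeta i) :
    laxL D A0 A1 w = ∑ i, (D.residue i / (w - D.zeta i)) • gaudinLax D A0 A1 (D.zeta i) := by
  rw [sum_smul_gaudinLax, laxL, gaudinLax, Finset.smul_sum]
  refine Finset.sum_congr rfl fun t _ => ?_
  have hp : D.prodZ t w ≠ 0 := D.prodZ_ne_zero_iff.2 fun q _ => hz q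
  have hzt : w - D.z t ≠ 0 := sub_ne_zero.2 (hz t)
  have h1 : ∑ i, D.residue i / (w - D.zeta i) * D.invZ i t ^ 2 =
      1 / D.twist w * (1 / (w - D.z t) ^ 2) := by
    have := hD.sum_residue_sq t hw
    rw [hD.twist_eq hz, ← D.sub_mul_prodZ t]
    calc _ = _ := Finset.sum_congr rfl fun i _ => by ring
      _ = _ := this
      _ = _ := by field_simp
  have h2 : ∑ i, D.residue i / (w - D.zeta i) * D.invZ i t =
      1 / D.twist w * (1 / (w - D.z t)) := by
    have := hD.sum_residue t hw
    rw [hD.twist_eq hz, ← D.sub_mul_prodZ t]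
    calc _ = _ := Finset.sum_congr rfl fun i _ => by ring
      _ = _ := this
      _ = _ := by field_simp
  rw [h1, h2, smul_add, TensorProduct.smul_tmul', TensorProduct.smul_tmul', smul_eq_mul,
    smul_eq_mul]

/-- The Lax pair is interpolated by its values at the sites. -/
lemma laxPair_eq (hD : D.Admissible) (s : ℤˣ) (A0 A1 : Fin (n + 1) → L) {w : ℂ}
    (hz : ∀ r, w ≠ D.z r) (hw : ∀ i, w ≠ D.zeta i) :
    laxPair D s A0 A1 w = interpolatedLax D s (siteLax D s 1 A0 A1) w := by
  have h1 : laxPair D s A0 A1 w = ∑ i, (D.laxWeight s i * D.residue i / (w - D.zeta i)) •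
      gaudinLax D A0 A1 (D.zeta i) := by
    rw [laxPair, laxL_eq hD A0 A1 hz hw, laxM, Finset.smul_sum, ← Finset.sum_add_distrib]
    refine Finset.sum_congr rfl fun i _ => ?_
    rw [smul_smul, ← add_smul, GaudinData.residue, GaudinData.laxWeight]
    congr 1
    ring
  have h2 : ∀ a : ℕ, (a = 1 ∨ a = 2) → ∀ t,
      ∑ i, D.laxWeight s i * D.residue i / (w - D.zeta i) * D.invZ i t ^ a =
      ∑ r, D.interp s r w * ((D.moment (D.laxWeight s) 1 a r t).re : ℂ) := by
    intro a ha t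
    have := hD.sum_poles_interp s (fun i => D.laxWeight s i * D.residue i * D.invZ i t ^ a)
      (fun i hi => by simp [D.laxWeight_eq_zero hi]) hw
    calc _ = _ := Finset.sum_congr rfl fun i _ => by ring
      _ = _ := this
      _ = _ := Finset.sum_congr rfl fun r _ => by
        rw [hD.ofReal_moment_laxWeight_re s a ha, GaudinData.Admissible.sum_poles_one]
  have h3 := h2 1 (Or.inl rfl)
  simp only [pow_one] at h3
  rw [h1, sum_smul_gaudinLax, interpolatedLax]
  simp only [h2 2 (Or.inr rfl), h3, siteLax, laxSum, TensorProduct.sum_tmul,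
    TensorProduct.tmul_sum, ← Finset.sum_add_distrib]
  rw [Finset.sum_comm]
  refine Finset.sum_congr rfl fun r _ => Finset.sum_congr rfl fun t _ => ?_
  rw [TensorProduct.tmul_add, TensorProduct.tmul_smul, TensorProduct.tmul_smul,
    TensorProduct.smul_tmul', TensorProduct.smul_tmul', add_comm]
  simp only [Complex.real_smul, mul_comm, GaudinData.interp]

/-! #### The Hamiltonian density -/

variable (D) in
/-- The symmetric bilinear form whose quadratic form is the Hamiltonian density. -/
def hamPolar (A0 A1 B0 B1 : Fin (n + 1) → L) : ℝ :=
  1 / 2 * ∑ q, (kap (A0 q) (siteM D 1 B0 B1 q) + kap (A1 q) (siteM D 2 B0 B1 q))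

lemma hamPolar_eq (A0 A1 B0 B1 : Fin (n + 1) → L) :
    hamPolar D A0 A1 B0 B1 = 1 / 2 * ∑ q, ∑ t,
      ((D.moment (fun i => sgn (D.eps i)) 1 1 q t).re * kap (A0 q) (B0 t) +
        (D.moment (fun i => sgn (D.eps i)) 1 2 q t).re * kap (A0 q) (B1 t) +
        (D.moment (fun i => sgn (D.eps i)) 2 1 q t).re * kap (A1 q) (B0 t) +
        (D.moment (fun i => sgn (D.eps i)) 2 2 q t).re * kap (A1 q) (B1 t)) := by
  simp only [hamPolar, siteM, laxSum, map_sum, map_add, map_smul, smul_eq_mul,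
    ← Finset.sum_add_distrib]
  simp only [add_assoc]

/-- Symmetry of `κ` combined with `moment_comm`. -/
lemma hamPolar_comm (A0 A1 B0 B1 : Fin (n + 1) → L) :
    hamPolar D A0 A1 B0 B1 = hamPolar D B0 B1 A0 A1 := by
  rw [hamPolar_eq, hamPolar_eq, Finset.sum_comm]
  congr 1
  refine Finset.sum_congr rfl fun q _ => Finset.sum_congr rfl fun t _ => ?_
  rw [D.moment_comm _ 1 1 t q, D.moment_comm _ 1 2 t q, D.moment_comm _ 2 1 t q,
    D.moment_comm _ 2 2 t q, kap_comm (A0 t), kap_comm (A0 t), kap_comm (A1 t), kap_comm (A1 t)]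
  ring

lemma hamDensityC_eq [Module.Finite ℝ L] (hD : D.Admissible) (A0 A1 : Fin (n + 1) → L) :
    hamDensityC D A0 A1 = (hamPolar D A0 A1 A0 A1 : ℝ) := by
  have h1 : ∀ i, kapC (gaudinLax D A0 A1 (D.zeta i)) (gaudinLax D A0 A1 (D.zeta i)) =
      ∑ q, ∑ t, (D.invZ i q * D.invZ i t * (kap (A0 q) (A0 t) : ℝ) +
        D.invZ i q * D.invZ i t ^ 2 * (kap (A0 q) (A1 t) : ℝ) +
        D.invZ i q ^ 2 * D.invZ i t * (kap (A1 q) (A0 t) : ℝ) +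
        D.invZ i q ^ 2 * D.invZ i t ^ 2 * (kap (A1 q) (A1 t) : ℝ)) := by
    intro i
    simp only [gaudinLax, map_sum, LinearMap.sum_apply, map_add, LinearMap.add_apply, kapC_tmul]
    rw [Finset.sum_comm]
    refine Finset.sum_congr rfl fun q _ => ?_
    rw [← Finset.sum_add_distrib]
    refine Finset.sum_congr rfl fun t _ => ?_
    simp only [GaudinData.invZ, one_div_pow]
    ring
  rw [hamPolar_eq]
  push_cast
  simp only [hD.ofReal_moment_re]
  simp only [hamDensityC, h1, GaudinData.moment, Finset.mul_sum,
    Finset.sum_mul, ← Finset.sum_neg_distrib, ← Finset.sum_add_distrib]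
  rw [Finset.sum_comm]
  refine Finset.sum_congr rfl fun q _ => ?_
  rw [Finset.sum_comm]
  refine Finset.sum_congr rfl fun t _ => Finset.sum_congr rfl fun i _ => ?_
  rw [GaudinData.residue]
  ring

lemma hamDensity_eq [Module.Finite ℝ L] (hD : D.Admissible) (A0 A1 : Fin (n + 1) → L) :
    hamDensity D A0 A1 = hamPolar D A0 A1 A0 A1 := by
  rw [hamDensity, hamDensityC_eq hD, Complex.ofReal_re]

/-- Symmetry of the form doubles the factor `1/2`: the `κ`-gradients of the density in `𝒥_[0]` and
`𝒥_[1]` at site `q` are `ℳ(z_q)` and `ℳ'(z_q)`. -/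
lemma hasDerivAt_hamDensity [Module.Finite ℝ L] (hD : D.Admissible)
    (A0 A1 B0 B1 : Fin (n + 1) → L) :
    HasDerivAt (fun a : ℝ => hamDensity D (A0 + a • B0) (A1 + a • B1))
      (∑ q, (kap (B0 q) (siteM D 1 A0 A1 q) + kap (B1 q) (siteM D 2 A0 A1 q))) 0 := by
  have hl : ∀ (a : ℝ) (C0 C1 C0' C1' E0 E1 : Fin (n + 1) → L),
      hamPolar D (C0 + a • C0') (C1 + a • C1') E0 E1 =
        hamPolar D C0 C1 E0 E1 + a * hamPolar D C0' C1' E0 E1 := by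
    intro a C0 C1 C0' C1' E0 E1
    simp only [hamPolar, Pi.add_apply, Pi.smul_apply, map_add, map_smul, LinearMap.add_apply,
      LinearMap.smul_apply, smul_eq_mul, Finset.sum_add_distrib, ← Finset.mul_sum]
    ring
  have h : (fun a : ℝ => hamDensity D (A0 + a • B0) (A1 + a • B1)) = fun a : ℝ =>
      hamPolar D A0 A1 A0 A1 + a * (2 * hamPolar D B0 B1 A0 A1) +
        a ^ 2 * hamPolar D B0 B1 B0 B1 := by
    funext a
    rw [hamDensity_eq hD, hl, hamPolar_comm A0 A1, hamPolar_comm B0 B1, hl, hl,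
      hamPolar_comm A0 A1 B0 B1]
    ring
  rw [h]
  have h1 := (((hasDerivAt_id (0 : ℝ)).mul_const (2 * hamPolar D B0 B1 A0 A1)).const_add
    (hamPolar D A0 A1 A0 A1)).add
      (((hasDerivAt_id (0 : ℝ)).pow 2).mul_const (hamPolar D B0 B1 B0 B1))
  refine h1.congr_deriv ?_
  simp [hamPolar]

end Algebra

/-! ### Hamilton equations, momenta and the Lagrangian density at one space-time point. -/

section Algebra

variable {L : Type*} [LieRing L] [LieAlgebra ℝ L] {n : ℕ} {D : GaudinData n}

lemma sgn_one : sgn 1 = 1 := by simp [sgn]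

lemma sgn_neg_one : sgn (-1) = -1 := by simp [sgn]

lemma kap_ext (hκ : (kap : LinearMap.BilinForm ℝ L).Nondegenerate) {x y : L}
    (h : ∀ z, kap x z = kap y z) : x = y := by
  rw [← sub_eq_zero]
  refine hκ.1 _ fun z => ?_
  rw [map_sub, LinearMap.sub_apply, h, sub_self]

lemma kap_sharp [Module.Finite ℝ L] (hκ : (kap : LinearMap.BilinForm ℝ L).Nondegenerate)
    (f : Module.Dual ℝ L) (x : L) : kap (sharp f) x = f x := by
  rw [sharp, dif_pos hκ]
  exact LinearMap.BilinForm.apply_toDual_symm_apply f x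

lemma IsSkew.kap_self {R : Module.End ℝ L} (hR : IsSkew R) (x : L) : kap x (R x) = 0 := by
  have h := hR x x
  rw [kap_comm] at h
  linarith

lemma IsSkew.kap_comm_neg {R : Module.End ℝ L} (hR : IsSkew R) (x y : L) :
    kap x (R y) = -kap y (R x) := by
  rw [kap_comm x, hR]

/-- This is `𝒥_[0] = ℓ ℒ'(z_q) - 2 k ℒ(z_q)` with `ℒ = (ℒ_+ - ℒ_-) / 2`. With `siteLax_two` it
recovers the momenta from the site values alone. -/
lemma currents_eq (hD : D.Admissible) (A0 A1 : Fin (n + 1) → L) (q : Fin (n + 1)) :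
    A0 q = (D.ell q / 2) • (siteLax D 1 2 A0 A1 q - siteLax D (-1) 2 A0 A1 q) -
      D.k q • (siteLax D 1 1 A0 A1 q - siteLax D (-1) 1 A0 A1 q) := by
  have hl := hD.ell_ne_zero q
  simp only [siteLax_one_eq hD, siteLax_two_eq hD, sgn_one, sgn_neg_one]
  match_scalars <;> field_simp <;> ring

lemma currents_eq_zero (hD : D.Admissible) {A0 A1 : Fin (n + 1) → L}
    (h : ∀ s q, siteLax D s 1 A0 A1 q = 0) : A0 = 0 := by
  funext q
  rw [currents_eq hD A0 A1 q]
  simp [siteLax_two hD, h]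

/-! #### The velocities -/

lemma isVelocity_pcm_iff [Module.Finite ℝ L] (hD : D.Admissible)
    (hκ : (kap : LinearMap.BilinForm ℝ L).Nondegenerate) (j W X v : Fin (n + 1) → L) :
    IsVelocity (fun X => hamDensity D (pcmCurrent0 D j W X) (pcmCurrent1 D j)) X v ↔
      ∀ r, v r = siteM D 1 (pcmCurrent0 D j W X) (pcmCurrent1 D j) r := by
  refine forall_congr' fun r => ?_
  have h : ∀ Y : L, HasDerivAt (fun a : ℝ => hamDensity D
      (pcmCurrent0 D j W (Function.update X r (X r + a • Y))) (pcmCurrent1 D j))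
      (kap (siteM D 1 (pcmCurrent0 D j W X) (pcmCurrent1 D j) r) Y) 0 := by
    intro Y
    have h1 := hasDerivAt_hamDensity hD (pcmCurrent0 D j W X) (pcmCurrent1 D j)
      (Pi.single r Y) 0
    have h2 : ∀ a : ℝ, pcmCurrent0 D j W (Function.update X r (X r + a • Y)) =
        pcmCurrent0 D j W X + a • (Pi.single r Y : Fin (n + 1) → L) := by
      intro a
      funext q
      rcases eq_or_ne q r with rfl | hq
      · simp [pcmCurrent0]; abel
      · simp [pcmCurrent0, hq]
    simp only [h2]
    simp only [smul_zero, add_zero] at h1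
    refine h1.congr_deriv ?_
    rw [Finset.sum_eq_single r]
    · simp [kap_comm]
    · intro q _ hq; simp [hq]
    · simp
  constructor
  · exact fun hv => kap_ext hκ fun Y => (hv Y).unique (h Y)
  · intro hv Y
    rw [hv]
    exact h Y

/-- `X_N` also enters `𝒥_[1]` through `-R_g X_N`; skew-symmetry moves `-R_g` to the other side of
`κ` as `+R_g`, which yields the extra term `R_g ℳ'(z_N)`. -/
lemma isVelocity_hyb_iff [Module.Finite ℝ L] (hD : D.Admissible)
    (hκ : (kap : LinearMap.BilinForm ℝ L).Nondegenerate) {Rg : Module.End ℝ L} (hR : IsSkew Rg)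
    (j W X v : Fin (n + 1) → L) :
    IsVelocity (fun X => hamDensity D (hybCurrent0 D j W X) (hybCurrent1 D Rg j X)) X v ↔
      ∀ r, v r = siteM D 1 (hybCurrent0 D j W X) (hybCurrent1 D Rg j X) r +
        if r = Fin.last n then
          Rg (siteM D 2 (hybCurrent0 D j W X) (hybCurrent1 D Rg j X) (Fin.last n)) else 0 := by
  refine forall_congr' fun r => ?_
  have h : ∀ Y : L, HasDerivAt (fun a : ℝ => hamDensity D
      (hybCurrent0 D j W (Function.update X r (X r + a • Y)))
      (hybCurrent1 D Rg j (Function.update X r (X r + a • Y))))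
      (kap (siteM D 1 (hybCurrent0 D j W X) (hybCurrent1 D Rg j X) r +
        if r = Fin.last n then
          Rg (siteM D 2 (hybCurrent0 D j W X) (hybCurrent1 D Rg j X) (Fin.last n)) else 0) Y) 0 := by
    intro Y
    have h1 := hasDerivAt_hamDensity hD (hybCurrent0 D j W X) (hybCurrent1 D Rg j X)
      (Pi.single r Y) (if r = Fin.last n then Pi.single r (-Rg Y) else 0)
    have h2 : ∀ a : ℝ, hybCurrent0 D j W (Function.update X r (X r + a • Y)) =
        hybCurrent0 D j W X + a • (Pi.single r Y : Fin (n + 1) → L) := by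
      intro a
      funext q
      rcases eq_or_ne q r with rfl | hq
      · rcases eq_or_ne q (Fin.last n) with rfl | hn
        · simp [hybCurrent0]
        · simp [hybCurrent0, pcmCurrent0, hn]; abel
      · rcases eq_or_ne q (Fin.last n) with rfl | hn
        · simp [hybCurrent0, hq]
        · simp [hybCurrent0, pcmCurrent0, hq, hn]
    have h3 : ∀ a : ℝ, hybCurrent1 D Rg j (Function.update X r (X r + a • Y)) =
        hybCurrent1 D Rg j X +
          a • (if r = Fin.last n then Pi.single r (-Rg Y) else 0 : Fin (n + 1) → L) := by
      intro a
      funext q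
      rcases eq_or_ne r (Fin.last n) with rfl | hn
      · rcases eq_or_ne q (Fin.last n) with rfl | hq
        · simp [hybCurrent1]; abel
        · simp [hybCurrent1, hq]
      · rcases eq_or_ne q (Fin.last n) with rfl | hq
        · simp [hybCurrent1, hn, hn.symm]
        · simp [hybCurrent1, hq, hn]
    simp only [h2, h3]
    refine h1.congr_deriv ?_
    rw [Finset.sum_eq_single r]
    · split_ifs with hr
      · subst hr
        simp only [Pi.single_eq_same, map_add, map_neg, LinearMap.add_apply, LinearMap.neg_apply]
        rw [hR Y, neg_neg, kap_comm (siteM D 1 _ _ _) Y, kap_comm (Rg _) Y]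
      · simp [kap_comm]
    · intro q _ hq
      split_ifs <;> simp [hq]
    · simp
  constructor
  · exact fun hv => kap_ext hκ fun Y => (hv Y).unique (h Y)
  · intro hv Y
    rw [hv]
    exact h Y

/-! #### The values of the Lax pair at the sites -/

lemma siteLax_pcm (hD : D.Admissible) {j W X v : Fin (n + 1) → L}
    (hv : ∀ r, v r = siteM D 1 (pcmCurrent0 D j W X) (pcmCurrent1 D j) r) (s : ℤˣ) :
    siteLax D s 1 (pcmCurrent0 D j W X) (pcmCurrent1 D j) = fun r => v r + sgn s • j r := by
  funext r
  rw [siteLax_one_eq hD, ← hv, pcmCurrent1, smul_smul (1 / D.ell r),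
    one_div_mul_cancel (hD.ell_ne_zero r), one_smul]

/-- The values of the Lax pair at the sites when the last current is `ℓ j - R_g 𝒥_{[0]}`. -/
lemma siteLax_hyb_eq (hD : D.Admissible) (hk : D.k (Fin.last n) = 0) {Rg : Module.End ℝ L}
    {A0 A1 j v : Fin (n + 1) → L}
    (hA1 : ∀ r, A1 r = D.ell r • j r - if r = Fin.last n then Rg (A0 (Fin.last n)) else 0)
    (hv : ∀ r, v r = siteM D 1 A0 A1 r +
      if r = Fin.last n then Rg (siteM D 2 A0 A1 (Fin.last n)) else 0) (s : ℤˣ)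
    (r : Fin (n + 1)) :
    siteLax D s 1 A0 A1 r = v r + sgn s • j r -
      if r = Fin.last n then Rg (siteLax D s 2 A0 A1 (Fin.last n)) else 0 := by
  have hl := hD.ell_ne_zero r
  rw [siteLax_one_eq hD, siteLax_two_eq hD, hv, hA1]
  split_ifs with h
  · subst h
    simp only [hk, map_add, map_smul]
    match_scalars <;> field_simp <;> ring
  · match_scalars <;> field_simp

lemma siteLax_hyb (hD : D.Admissible) (hk : D.k (Fin.last n) = 0) {Rg : Module.End ℝ L}
    {A0 A1 j v : Fin (n + 1) → L}
    (hA1 : ∀ r, A1 r = D.ell r • j r - if r = Fin.last n then Rg (A0 (Fin.last n)) else 0)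
    (hv : ∀ r, v r = siteM D 1 A0 A1 r +
      if r = Fin.last n then Rg (siteM D 2 A0 A1 (Fin.last n)) else 0) (s : ℤˣ)
    (hu : IsUnit (1 + (sgn s * D.theta) • Rg)) :
    siteLax D s 1 A0 A1 = Function.update (fun r => v r + sgn s • j r) (Fin.last n)
      (deformedCurrent D Rg s fun r => v r + sgn s • j r) := by
  have h1 := siteLax_hyb_eq hD hk hA1 hv s
  have hne : ∀ r, r ≠ Fin.last n → siteLax D s 1 A0 A1 r = v r + sgn s • j r := by
    intro r hr
    rw [h1, if_neg hr, sub_zero]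
  funext r
  rcases eq_or_ne r (Fin.last n) with rfl | hr
  · rw [Function.update_self, deformedCurrent]
    have h2 := siteLax_two hD s A0 A1 (Fin.last n)
    rw [← Finset.add_sum_erase _ _ (Finset.mem_univ (Fin.last n)), GaudinData.Admissible.derivCoeff_last hk] at h2
    -- In the interpolated derivative the term of the last site has coefficient `± ϑ`, because `k_N
    -- = 0`; moved to the left it forms `1 ± ϑ R_g`.
    have h3 : (1 + (sgn s * D.theta) • Rg) (siteLax D s 1 A0 A1 (Fin.last n)) =
        (v (Fin.last n) + sgn s • j (Fin.last n)) - (sgn s * (2 / D.ell (Fin.last n))) •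
          ∑ r ∈ Finset.univ.erase (Fin.last n),
            (if s = 1 then D.rho r (Fin.last n) else D.rho (Fin.last n) r) •
              Rg (v r + sgn s • j r) := by
      have h4 := h1 (Fin.last n)
      rw [if_pos rfl, h2, map_add, map_smul, map_sum] at h4
      rw [LinearMap.add_apply, LinearMap.smul_apply, Module.End.one_apply]
      have h5 : ∑ r ∈ Finset.univ.erase (Fin.last n),
          Rg (D.derivCoeff s (Fin.last n) r • siteLax D s 1 A0 A1 r) =
          (sgn s * (2 / D.ell (Fin.last n))) • ∑ r ∈ Finset.univ.erase (Fin.last n),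
            (if s = 1 then D.rho r (Fin.last n) else D.rho (Fin.last n) r) •
              Rg (v r + sgn s • j r) := by
        rw [Finset.smul_sum]
        refine Finset.sum_congr rfl fun r hr => ?_
        have hr := Finset.ne_of_mem_erase hr
        rw [hne r hr, map_smul, smul_smul]
        congr 1
        rw [GaudinData.derivCoeff, if_neg hr]
        rcases Int.units_eq_one_or s with rfl | rfl
        · rw [if_pos rfl, if_pos rfl, sgn_one]; ring
        · rw [if_neg (by decide), if_neg (by decide), sgn_neg_one]; ring
      rw [← h5]
      nth_rewrite 1 [h4]
      abel
    rw [← h3, ← Module.End.mul_apply, Ring.inverse_mul_cancel _ hu, Module.End.one_apply]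
  · rw [Function.update_of_ne hr, hne r hr]

lemma hybCurrent1_apply (Rg : Module.End ℝ L) (j W X : Fin (n + 1) → L) (r : Fin (n + 1)) :
    hybCurrent1 D Rg j X r = D.ell r • j r -
      if r = Fin.last n then Rg (hybCurrent0 D j W X (Fin.last n)) else 0 := by
  rcases eq_or_ne r (Fin.last n) with rfl | hr
  · simp [hybCurrent1, hybCurrent0]
  · simp [hybCurrent1, pcmCurrent1, hr]

/-! #### Existence and uniqueness of the momenta -/

lemma existsUnique_of_affine {V : Type*} [AddCommGroup V] [Module ℝ V] [Module.Finite ℝ V]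
    (T : V →ₗ[ℝ] V) (hT : ∀ x, T x = 0 → x = 0) (c : V) : ∃! x, c = T x := by
  have hinj : Function.Injective T := (injective_iff_map_eq_zero T).2 hT
  obtain ⟨x, hx⟩ := LinearMap.injective_iff_surjective.1 hinj c
  exact ⟨x, hx.symm, fun y hy => hinj (hy.symm.trans hx.symm)⟩

/-- The system is affine in `X` and square, so only the homogeneous system matters. There `𝒥_[1] =
0`, so `ℳ(z_q) = 0` makes both `ℒ_±` vanish at all sites, and `currents_eq_zero` applies. -/
lemma existsUnique_pcm [Module.Finite ℝ L] (hD : D.Admissible) (j W v : Fin (n + 1) → L) :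
    ∃! X, ∀ r, v r = siteM D 1 (pcmCurrent0 D j W X) (pcmCurrent1 D j) r := by
  let T : (Fin (n + 1) → L) →ₗ[ℝ] (Fin (n + 1) → L) :=
    { toFun := fun X => siteM D 1 X 0
      map_add' := fun X Y => by
        funext r
        have h := laxSum_add (D := D) (fun i => sgn (D.eps i)) 1 X 0 Y 0 r
        rwa [add_zero] at h
      map_smul' := fun a X => by
        funext r
        have h := laxSum_smul (D := D) (fun i => sgn (D.eps i)) 1 a X 0 r
        rwa [smul_zero] at h }
  have hT : ∀ X, T X = 0 → X = 0 := by
    intro X hX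
    refine currents_eq_zero hD (A1 := 0) fun s q => ?_
    rw [siteLax_one_eq hD]
    have : siteM D 1 X 0 q = 0 := congrFun hX q
    simp [this]
  have h0 : ∀ X r, siteM D 1 (pcmCurrent0 D j W X) (pcmCurrent1 D j) r =
      T X r + siteM D 1 (pcmCurrent0 D j W 0) (pcmCurrent1 D j) r := by
    intro X r
    have h := laxSum_add (D := D) (fun i => sgn (D.eps i)) 1 X 0 (pcmCurrent0 D j W 0)
      (pcmCurrent1 D j) r
    rw [zero_add] at h
    refine Eq.trans ?_ h
    congr 1
    funext q
    simp [pcmCurrent0]; abel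
  have h1 := existsUnique_of_affine T hT
    (v - siteM D 1 (pcmCurrent0 D j W 0) (pcmCurrent1 D j))
  refine (existsUnique_congr fun X => ?_).1 h1
  rw [sub_eq_iff_eq_add, funext_iff]
  exact forall_congr' fun r => by rw [h0]; rfl

lemma existsUnique_hyb [Module.Finite ℝ L] (hD : D.Admissible) (hk : D.k (Fin.last n) = 0)
    {Rg : Module.End ℝ L} (hu : ∀ s, IsUnit (1 + (sgn s * D.theta) • Rg))
    (j W v : Fin (n + 1) → L) :
    ∃! X, ∀ r, v r = siteM D 1 (hybCurrent0 D j W X) (hybCurrent1 D Rg j X) r +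
        if r = Fin.last n then
          Rg (siteM D 2 (hybCurrent0 D j W X) (hybCurrent1 D Rg j X) (Fin.last n)) else 0 := by
  -- The part of `𝒥_[1]` that is linear in the momenta.
  let N : (Fin (n + 1) → L) →ₗ[ℝ] (Fin (n + 1) → L) :=
    LinearMap.single ℝ (fun _ => L) (Fin.last n) ∘ₗ (-Rg) ∘ₗ LinearMap.proj (Fin.last n)
  have hN : ∀ X r, N X r = -if r = Fin.last n then Rg (X (Fin.last n)) else 0 := by
    intro X r
    rcases eq_or_ne r (Fin.last n) with rfl | hr
    · simp [N]
    · simp [N, hr]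
  let F : (Fin (n + 1) → L) → (Fin (n + 1) → L) → Fin (n + 1) → L := fun A0 A1 r =>
    siteM D 1 A0 A1 r + if r = Fin.last n then Rg (siteM D 2 A0 A1 (Fin.last n)) else 0
  have hFadd : ∀ A0 A1 B0 B1, F (A0 + B0) (A1 + B1) = F A0 A1 + F B0 B1 := by
    intro A0 A1 B0 B1
    funext r
    simp only [F, siteM, laxSum_add, Pi.add_apply, map_add]
    split_ifs <;> abel
  have hFsmul : ∀ (a : ℝ) A0 A1, F (a • A0) (a • A1) = a • F A0 A1 := by
    intro a A0 A1
    funext r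
    simp only [F, siteM, laxSum_smul, Pi.smul_apply, map_smul]
    split_ifs <;> simp
  let T : (Fin (n + 1) → L) →ₗ[ℝ] (Fin (n + 1) → L) :=
    { toFun := fun X => F X (N X)
      map_add' := fun X Y => by rw [map_add, hFadd]
      map_smul' := fun a X => by rw [map_smul, hFsmul]; rfl }
  have hT : ∀ X, T X = 0 → X = 0 := by
    intro X hX
    -- The homogeneous system is the deformed model with `j = 0` and zero velocities, so
    -- `siteLax_hyb` makes all site values vanish.
    refine currents_eq_zero hD (A1 := N X) fun s q => ?_
    rw [siteLax_hyb hD hk (j := 0) (v := 0) (Rg := Rg) (fun r => by simp [hN])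
      (fun r => (congrFun hX r).symm) s (hu s)]
    rcases eq_or_ne q (Fin.last n) with rfl | hq
    · simp [deformedCurrent]
    · simp [hq]
  have h0 : ∀ X, F (hybCurrent0 D j W X) (hybCurrent1 D Rg j X) =
      T X + F (hybCurrent0 D j W 0) (hybCurrent1 D Rg j 0) := by
    intro X
    change _ = F X (N X) + _
    rw [← hFadd]
    congr 1
    · funext q
      rcases eq_or_ne q (Fin.last n) with rfl | hq
      · simp [hybCurrent0]
      · simp [hybCurrent0, pcmCurrent0, hq]; abel
    · funext q
      rw [Pi.add_apply, hN]
      rcases eq_or_ne q (Fin.last n) with rfl | hq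
      · simp [hybCurrent1]; abel
      · simp [hybCurrent1, hq]
  have h1 := existsUnique_of_affine T hT
    (v - F (hybCurrent0 D j W 0) (hybCurrent1 D Rg j 0))
  refine (existsUnique_congr fun X => ?_).1 h1
  rw [sub_eq_iff_eq_add, ← h0, funext_iff]

/-! #### The Lagrangian density -/

/-- Inserting `ℒ_± = ℳ ± ℒ`, the bracket collapses to `2 (κ(ℒ', ℳ) - κ(ℒ, ℳ'))`. The right side is
what the Legendre transform leaves at an undeformed site, up to the Wess–Zumino part. -/
lemma kap_site (hD : D.Admissible) (A0 A1 : Fin (n + 1) → L) (q : Fin (n + 1)) :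
    D.ell q / 4 * (kap (siteLax D 1 2 A0 A1 q) (siteLax D (-1) 1 A0 A1 q) -
        kap (siteLax D 1 1 A0 A1 q) (siteLax D (-1) 2 A0 A1 q)) =
      1 / 2 * (kap (A0 q) (siteM D 1 A0 A1 q) - kap (A1 q) (siteM D 2 A0 A1 q)) +
        D.k q / D.ell q * kap (A1 q) (siteM D 1 A0 A1 q) := by
  have hl := hD.ell_ne_zero q
  simp only [siteLax_one_eq hD, siteLax_two_eq hD, sgn_one, sgn_neg_one, map_add, map_smul,
    LinearMap.add_apply, LinearMap.smul_apply, smul_eq_mul]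
  rw [kap_comm (siteM D 2 A0 A1 q) (siteM D 1 A0 A1 q), kap_comm (siteM D 2 A0 A1 q) (A1 q),
    kap_comm (siteM D 1 A0 A1 q) (A0 q), kap_comm (siteM D 1 A0 A1 q) (A1 q),
    kap_comm (A1 q) (A0 q)]
  field_simp
  ring

lemma ell_smul_siteLax_plus (hD : D.Admissible) (A0 A1 : Fin (n + 1) → L) (q : Fin (n + 1)) :
    D.ell q • siteLax D 1 2 A0 A1 q = (2 : ℝ) • ∑ r, D.rho r q • siteLax D 1 1 A0 A1 r +
      D.k q • siteLax D 1 1 A0 A1 q := by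
  have hl := hD.ell_ne_zero q
  have h : D.k q • siteLax D 1 1 A0 A1 q =
      ∑ r, (if r = q then D.k q else 0) • siteLax D 1 1 A0 A1 r := by simp
  rw [siteLax_two hD, h, Finset.smul_sum, Finset.smul_sum, ← Finset.sum_add_distrib]
  refine Finset.sum_congr rfl fun r _ => ?_
  rw [GaudinData.derivCoeff, if_pos rfl]
  match_scalars
  field_simp

lemma ell_smul_siteLax_minus (hD : D.Admissible) (A0 A1 : Fin (n + 1) → L) (q : Fin (n + 1)) :
    D.ell q • siteLax D (-1) 2 A0 A1 q =
      -((2 : ℝ) • ∑ r, D.rho q r • siteLax D (-1) 1 A0 A1 r) +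
      D.k q • siteLax D (-1) 1 A0 A1 q := by
  have hl := hD.ell_ne_zero q
  have h : D.k q • siteLax D (-1) 1 A0 A1 q =
      ∑ r, (if r = q then D.k q else 0) • siteLax D (-1) 1 A0 A1 r := by simp
  rw [siteLax_two hD, h, Finset.smul_sum, Finset.smul_sum, ← Finset.sum_neg_distrib,
    ← Finset.sum_add_distrib]
  refine Finset.sum_congr rfl fun r _ => ?_
  rw [GaudinData.derivCoeff, if_neg (by decide)]
  match_scalars
  field_simp

/-- The `k_q` contributions cancel in the difference, and each of the two derivatives supplies half
of the double sum in `ρ`. -/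
lemma sum_kap_site (hD : D.Admissible) (A0 A1 : Fin (n + 1) → L) :
    ∑ q, D.ell q / 4 * (kap (siteLax D 1 2 A0 A1 q) (siteLax D (-1) 1 A0 A1 q) -
        kap (siteLax D 1 1 A0 A1 q) (siteLax D (-1) 2 A0 A1 q)) =
      ∑ r, ∑ s, D.rho r s * kap (siteLax D 1 1 A0 A1 r) (siteLax D (-1) 1 A0 A1 s) := by
  have h : ∀ q, D.ell q / 4 * (kap (siteLax D 1 2 A0 A1 q) (siteLax D (-1) 1 A0 A1 q) -
        kap (siteLax D 1 1 A0 A1 q) (siteLax D (-1) 2 A0 A1 q)) =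
      1 / 2 * ∑ r, D.rho r q * kap (siteLax D 1 1 A0 A1 r) (siteLax D (-1) 1 A0 A1 q) +
      1 / 2 * ∑ r, D.rho q r * kap (siteLax D 1 1 A0 A1 q) (siteLax D (-1) 1 A0 A1 r) := by
    intro q
    have h1 := congrArg (fun x => kap x (siteLax D (-1) 1 A0 A1 q))
      (ell_smul_siteLax_plus hD A0 A1 q)
    have h2 := congrArg (fun x => kap (siteLax D 1 1 A0 A1 q) x)
      (ell_smul_siteLax_minus hD A0 A1 q)
    simp only [map_add, map_smul, map_neg, map_sum, LinearMap.add_apply, LinearMap.smul_apply,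
      LinearMap.sum_apply, smul_eq_mul] at h1 h2
    linear_combination (1 / 4 : ℝ) * h1 - (1 / 4 : ℝ) * h2
  simp only [h, Finset.sum_add_distrib, ← Finset.mul_sum]
  rw [Finset.sum_comm]
  ring

/-- The Lagrangian density in terms of the values of the Lax pair at the sites. -/
lemma lagrangian_eq_siteLax [Module.Finite ℝ L] (hD : D.Admissible) (hk : D.k (Fin.last n) = 0)
    {Rg : Module.End ℝ L} (hR : IsSkew Rg) {j W X v : Fin (n + 1) → L}
    (hv : ∀ r, v r = siteM D 1 (hybCurrent0 D j W X) (hybCurrent1 D Rg j X) r +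
        if r = Fin.last n then
          Rg (siteM D 2 (hybCurrent0 D j W X) (hybCurrent1 D Rg j X) (Fin.last n)) else 0) :
    ∑ r, kap (X r) (v r) - hamDensity D (hybCurrent0 D j W X) (hybCurrent1 D Rg j X) =
      ∑ r, ∑ s, D.rho r s *
        kap (siteLax D 1 1 (hybCurrent0 D j W X) (hybCurrent1 D Rg j X) r)
          (siteLax D (-1) 1 (hybCurrent0 D j W X) (hybCurrent1 D Rg j X) s) +
      D.ell (Fin.last n) / 2 *
        kap (siteLax D 1 2 (hybCurrent0 D j W X) (hybCurrent1 D Rg j X) (Fin.last n))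
          (Rg (siteLax D (-1) 2 (hybCurrent0 D j W X) (hybCurrent1 D Rg j X) (Fin.last n))) +
      ∑ r ∈ Finset.univ.erase (Fin.last n), D.k r * kap (W r) (v r) := by
  set A0 := hybCurrent0 D j W X with hA0
  set A1 := hybCurrent1 D Rg j X with hA1
  rw [← sum_kap_site hD, hamDensity_eq hD, hamPolar, Finset.mul_sum, ← Finset.sum_sub_distrib,
    ← Finset.add_sum_erase _ _ (Finset.mem_univ (Fin.last n)),
    ← Finset.add_sum_erase (a := Fin.last n) Finset.univ (fun q => D.ell q / 4 * _)
      (Finset.mem_univ (Fin.last n))]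
  -- At the last site the velocity contributes the additional `κ(X_N, R_g ℳ'(z_N))`. By
  -- skew-symmetry, and since `k_N = 0`, this equals `ℓ_N / 2` times `κ(ℒ_+', R_g ℒ_-')` at `z_N`.
  have h1 : kap (X (Fin.last n)) (v (Fin.last n)) -
      1 / 2 * (kap (A0 (Fin.last n)) (siteM D 1 A0 A1 (Fin.last n)) +
        kap (A1 (Fin.last n)) (siteM D 2 A0 A1 (Fin.last n))) =
      D.ell (Fin.last n) / 4 *
        (kap (siteLax D 1 2 A0 A1 (Fin.last n)) (siteLax D (-1) 1 A0 A1 (Fin.last n)) -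
        kap (siteLax D 1 1 A0 A1 (Fin.last n)) (siteLax D (-1) 2 A0 A1 (Fin.last n))) +
      D.ell (Fin.last n) / 2 * kap (siteLax D 1 2 A0 A1 (Fin.last n))
          (Rg (siteLax D (-1) 2 A0 A1 (Fin.last n))) := by
    have hl := hD.ell_ne_zero (Fin.last n)
    have hX : X (Fin.last n) = A0 (Fin.last n) := by simp [hA0, hybCurrent0]
    rw [kap_site hD, hv, if_pos rfl, hX, siteLax_two_eq hD, siteLax_two_eq hD, hk]
    simp only [sgn_one, sgn_neg_one, map_add, map_smul, LinearMap.add_apply,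
      LinearMap.smul_apply, smul_eq_mul, hR.kap_self]
    rw [hR.kap_comm_neg (siteM D 2 A0 A1 (Fin.last n)) (A0 (Fin.last n))]
    field_simp
    ring
  have h2 : ∀ r ∈ Finset.univ.erase (Fin.last n), kap (X r) (v r) -
      1 / 2 * (kap (A0 r) (siteM D 1 A0 A1 r) + kap (A1 r) (siteM D 2 A0 A1 r)) =
      D.ell r / 4 * (kap (siteLax D 1 2 A0 A1 r) (siteLax D (-1) 1 A0 A1 r) -
        kap (siteLax D 1 1 A0 A1 r) (siteLax D (-1) 2 A0 A1 r)) + D.k r * kap (W r) (v r) := by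
    intro r hr
    have hr := Finset.ne_of_mem_erase hr
    have hl := hD.ell_ne_zero r
    have hX : X r = A0 r + D.k r • j r + D.k r • W r := by
      simp [hA0, hybCurrent0, pcmCurrent0, hr]; abel
    have hj : A1 r = D.ell r • j r := by simp [hA1, hybCurrent1, pcmCurrent1, hr]
    rw [kap_site hD, hv, if_neg hr, add_zero, hX, hj]
    simp only [map_add, map_smul, LinearMap.add_apply, LinearMap.smul_apply, smul_eq_mul]
    field_simp
    ring
  rw [h1, Finset.sum_congr rfl h2, Finset.sum_add_distrib]
  ring

lemma inverse_one_sub {Rg : Module.End ℝ L} {a : ℝ} (hu : IsUnit (1 - a • Rg)) :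
    Ring.inverse (1 - a • Rg) = 1 + a • (Rg * Ring.inverse (1 - a • Rg)) := by
  have h := Ring.mul_inverse_cancel _ hu
  rw [sub_mul, one_mul, smul_mul_assoc] at h
  exact sub_eq_iff_eq_add.1 h

/-- By the definition of `ϑ`, the prefactor `2 ρ_{rN} ρ_{NN} / ℓ_N` is `ρ_{rN} ϑ`, and `(1 - ϑ
R_g)⁻¹ = 1 + ϑ R_g (1 - ϑ R_g)⁻¹`. -/
lemma opO_last_right {Rg : Module.End ℝ L}
    (hu : IsUnit (1 - D.theta • Rg)) (r : Fin (n + 1)) :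
    opO D Rg r (Fin.last n) = D.rho r (Fin.last n) • Ring.inverse (1 - D.theta • Rg) := by
  rw [opO]
  nth_rewrite 2 [inverse_one_sub hu]
  rw [smul_add, smul_smul, GaudinData.theta]
  congr 2
  ring

lemma opO_last_left {Rg : Module.End ℝ L}
    (hu : IsUnit (1 - D.theta • Rg)) (r : Fin (n + 1)) :
    opO D Rg (Fin.last n) r = D.rho (Fin.last n) r • Ring.inverse (1 - D.theta • Rg) := by
  rw [opO]
  nth_rewrite 2 [inverse_one_sub hu]
  rw [smul_add, smul_smul, GaudinData.theta]
  congr 2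
  ring

/-- The deformed Lagrangian density in terms of the undeformed light-cone currents. -/
lemma sum_siteLax_eq_sum_opO (hD : D.Admissible) (hk : D.k (Fin.last n) = 0)
    {Rg : Module.End ℝ L} (hR : IsSkew Rg) (hu : IsUnit (1 - D.theta • Rg))
    {A0 A1 j v : Fin (n + 1) → L}
    (hA1 : ∀ r, A1 r = D.ell r • j r - if r = Fin.last n then Rg (A0 (Fin.last n)) else 0)
    (hv : ∀ r, v r = siteM D 1 A0 A1 r +
      if r = Fin.last n then Rg (siteM D 2 A0 A1 (Fin.last n)) else 0) :
    ∑ r, ∑ s, D.rho r s * kap (siteLax D 1 1 A0 A1 r) (siteLax D (-1) 1 A0 A1 s) +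
      D.ell (Fin.last n) / 2 * kap (siteLax D 1 2 A0 A1 (Fin.last n))
          (Rg (siteLax D (-1) 2 A0 A1 (Fin.last n))) =
      ∑ r, ∑ s, kap (v r + sgn 1 • j r) (opO D Rg r s (v s + sgn (-1) • j s)) := by
  have hl := hD.ell_ne_zero (Fin.last n)
  have hb0 := ell_smul_siteLax_minus hD A0 A1 (Fin.last n)
  have hp := siteLax_hyb_eq hD hk hA1 hv 1
  have hm := siteLax_hyb_eq hD hk hA1 hv (-1)
  set a := siteLax D 1 2 A0 A1 (Fin.last n)
  set b := siteLax D (-1) 2 A0 A1 (Fin.last n)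
  set c : Fin (n + 1) → L := fun r => v r + sgn 1 • j r with hc
  set d : Fin (n + 1) → L := fun r => v r + sgn (-1) • j r with hd
  replace hp : ∀ r, siteLax D 1 1 A0 A1 r = c r - if r = Fin.last n then Rg a else 0 := hp
  replace hm : ∀ r, siteLax D (-1) 1 A0 A1 r = d r - if r = Fin.last n then Rg b else 0 := hm
  change _ = ∑ r, ∑ s, kap (c r) (opO D Rg r s (d s))
  set α := ∑ r, D.rho r (Fin.last n) • c r with hα
  set β := ∑ r, D.rho (Fin.last n) r • d r with hβ
  have hb : β = D.rho (Fin.last n) (Fin.last n) • Rg b - (D.ell (Fin.last n) / 2) • b := by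
    simp only [hm, smul_sub, Finset.sum_sub_distrib, smul_ite, smul_zero,
      Finset.sum_ite_eq', Finset.mem_univ, if_true, hk, zero_smul] at hb0
    rw [← hβ] at hb0
    have : (D.ell (Fin.last n) / 2) • b = (1 / 2 : ℝ) • D.ell (Fin.last n) • b := by
      rw [smul_smul]; congr 1; ring
    rw [this, hb0]
    module
  -- The interpolated derivative of `ℒ_-` reads `β = -(ℓ_N / 2) (1 - ϑ R_g) b`. Thus the inverse
  -- operator in `opO` acts on `β` without being computed.
  have hinvb : Ring.inverse (1 - D.theta • Rg) β = -((D.ell (Fin.last n) / 2) • b) := by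
    have h : β = (1 - D.theta • Rg) (-((D.ell (Fin.last n) / 2) • b)) := by
      rw [hb, LinearMap.sub_apply, LinearMap.smul_apply, Module.End.one_apply, map_neg, map_smul,
        GaudinData.theta]
      match_scalars <;> field_simp
    rw [h, ← Module.End.mul_apply, Ring.inverse_mul_cancel _ hu, Module.End.one_apply]
  have hO : ∑ r, ∑ s, kap (c r) (opO D Rg r s (d s)) =
      ∑ r, ∑ s, D.rho r s * kap (c r) (d s) + 2 / D.ell (Fin.last n) *
        kap α (Rg (Ring.inverse (1 - D.theta • Rg) β)) := by
    have h1 : kap α (Rg (Ring.inverse (1 - D.theta • Rg) β)) = ∑ r, ∑ s,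
        D.rho r (Fin.last n) * D.rho (Fin.last n) s *
          kap (c r) (Rg (Ring.inverse (1 - D.theta • Rg) (d s))) := by
      rw [hα, map_sum, LinearMap.sum_apply]
      refine Finset.sum_congr rfl fun r _ => ?_
      simp only [hβ, map_sum, map_smul, LinearMap.smul_apply, smul_eq_mul]
      exact Finset.sum_congr rfl fun s _ => by ring
    rw [h1, Finset.mul_sum, ← Finset.sum_add_distrib]
    refine Finset.sum_congr rfl fun r _ => ?_
    rw [Finset.mul_sum, ← Finset.sum_add_distrib]
    refine Finset.sum_congr rfl fun s _ => ?_
    simp only [opO, map_smul, map_add, LinearMap.add_apply,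
      LinearMap.smul_apply, smul_eq_mul, Module.End.mul_apply, Module.End.one_apply]
    ring
  have hS : ∑ r, ∑ s, D.rho r s * kap (siteLax D 1 1 A0 A1 r) (siteLax D (-1) 1 A0 A1 s) =
      ∑ r, ∑ s, D.rho r s * kap (c r) (d s) - kap (Rg a) β - kap α (Rg b) +
        D.rho (Fin.last n) (Fin.last n) * kap (Rg a) (Rg b) := by
    have h1 : ∀ r s, D.rho r s * kap (siteLax D 1 1 A0 A1 r) (siteLax D (-1) 1 A0 A1 s) =
        D.rho r s * kap (c r) (d s) -
        (if r = Fin.last n then D.rho r s * kap (Rg a) (d s) else 0) -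
        (if s = Fin.last n then D.rho r s * kap (c r) (Rg b) else 0) +
        (if r = Fin.last n then (if s = Fin.last n then D.rho r s * kap (Rg a) (Rg b) else 0)
          else 0) := by
      intro r s
      rw [hp, hm]
      split_ifs <;> simp [map_sub, LinearMap.sub_apply] <;> ring
    simp only [h1, Finset.sum_add_distrib, Finset.sum_sub_distrib]
    rw [hα, hβ]
    simp only [map_sum, LinearMap.sum_apply, map_smul, LinearMap.smul_apply, smul_eq_mul]
    congr 1
    · congr 1
      · congr 1
        rw [Finset.sum_eq_single (Fin.last n)]
        · simp
        · intro r _ hr; simp [hr]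
        · simp
      · simp
    · rw [Finset.sum_eq_single (Fin.last n)]
      · simp
      · intro r _ hr; simp [hr]
      · simp
  -- The terms with `κ(α, R_g b)` agree on both sides and those with `ρ_{NN}` cancel. What is left
  -- is `ℓ_N / 2` times `κ(R_g a, b) + κ(a, R_g b)`, which is zero by skew-symmetry.
  rw [hO, hS, hinvb, hb]
  have h3 : kap (Rg a) b = -kap a (Rg b) := hR a b
  simp only [map_sub, map_neg, map_smul, smul_eq_mul, h3]
  field_simp
  ring

end Algebra

/-! ### Non-degeneracy of the Killing form. -/

section Simple

variable {L : Type*} [LieRing L] [LieAlgebra ℝ L] [Module.Finite ℝ L]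

/-- If the complexification of `𝔤₀` is simple then the Killing form of `𝔤₀` is non-degenerate. -/
lemma kap_nondegenerate (hs : LieAlgebra.IsSimple ℂ (ℂ ⊗[ℝ] L)) :
    (kap : LinearMap.BilinForm ℝ L).Nondegenerate := by
  -- Cartan's criterion over `ℂ`. It descends because the Killing form commutes with base change and
  -- `x ↦ 1 ⊗ x` is injective.
  have h0 := LieAlgebra.IsKilling.killingForm_nondegenerate ℂ (ℂ ⊗[ℝ] L)
  have h1 : (kap : LinearMap.BilinForm ℝ L).SeparatingLeft := by
    intro x hx
    have h2 : (1 : ℂ) ⊗ₜ[ℝ] x = 0 := by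
      refine h0.1 _ fun y => ?_
      induction y using TensorProduct.induction_on with
      | zero => simp
      | tmul a y =>
        have h3 : kapC ((1 : ℂ) ⊗ₜ[ℝ] x) (a ⊗ₜ[ℝ] y) = 0 := by rw [kapC_tmul, hx]; simp
        rwa [kapC, LinearMap.neg_apply, LinearMap.neg_apply, neg_eq_zero] at h3
      | add y z hy hz => rw [map_add, hy, hz, add_zero]
    have hinj : Function.Injective fun x : L => (1 : ℂ) ⊗ₜ[ℝ] x :=
      Module.FaithfullyFlat.tensorProduct_mk_injective (A := ℝ) (B := ℂ) L
    exact hinj (h2.trans (TensorProduct.tmul_zero _ _).symm)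
  exact ⟨h1, fun y hy => h1 y fun x => by rw [kap_comm, hy]⟩

end Simple

/-! ### The adjoint action: automorphisms of the Lie algebra and conjugation of `R`. -/

section Group

variable {E : Type*} [NormedAddCommGroup E] [NormedSpace ℝ E]
  {G : Type*} [TopologicalSpace G] [ChartedSpace E G]

/-- The derivative of a map at a point, as an endomorphism of the model space. -/
def modelDeriv (f : G → G) (x : G) : E →L[ℝ] E := mfderiv 𝓘(ℝ, E) 𝓘(ℝ, E) f x

lemma modelDeriv_comp {f₁ f₂ : G → G} (x : G)
    (h₁ : MDifferentiableAt 𝓘(ℝ, E) 𝓘(ℝ, E) f₁ (f₂ x))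
    (h₂ : MDifferentiableAt 𝓘(ℝ, E) 𝓘(ℝ, E) f₂ x) :
    modelDeriv (E := E) (f₁ ∘ f₂) x = (modelDeriv f₁ (f₂ x)).comp (modelDeriv f₂ x) :=
  mfderiv_comp x h₁ h₂

lemma modelDeriv_id (x : G) : modelDeriv (E := E) (id : G → G) x = ContinuousLinearMap.id ℝ E :=
  mfderiv_id

variable [Group G]

lemma Ad_apply (g : G) (v : GroupLieAlgebra 𝓘(ℝ, E) G) :
    Ad g v = modelDeriv (E := E) (fun h : G => g * h * g⁻¹) 1 v := rfl

variable [LieGroup 𝓘(ℝ, E) ∞ G]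

lemma contMDiff_conj (g : G) : ContMDiff 𝓘(ℝ, E) 𝓘(ℝ, E) ∞ (fun h : G => g * h * g⁻¹) :=
  (contMDiff_mul_left (I := 𝓘(ℝ, E)) (n := ∞) (a := g)).mul contMDiff_const

lemma mdifferentiableAt_conj (g h : G) :
    MDifferentiableAt 𝓘(ℝ, E) 𝓘(ℝ, E) (fun h : G => g * h * g⁻¹) h :=
  (contMDiff_conj g).mdifferentiableAt (by simp)

lemma mdifferentiableAt_mul_left (g h : G) :
    MDifferentiableAt 𝓘(ℝ, E) 𝓘(ℝ, E) (fun h : G => g * h) h :=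
  (contMDiff_mul_left (I := 𝓘(ℝ, E)) (n := ∞) (a := g)).mdifferentiableAt (by simp)

lemma modelDeriv_conj_inv (g x : G) :
    (modelDeriv (E := E) (fun h : G => g⁻¹ * h * g) (g * x * g⁻¹)).comp
      (modelDeriv (fun h : G => g * h * g⁻¹) x) = ContinuousLinearMap.id ℝ E := by
  have h0 := mdifferentiableAt_conj (E := E) g⁻¹ (g * x * g⁻¹)
  rw [inv_inv] at h0
  rw [← modelDeriv_comp (f₁ := fun h : G => g⁻¹ * h * g) (f₂ := fun h : G => g * h * g⁻¹) x h0
    (mdifferentiableAt_conj g x)]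
  have : ((fun h : G => g⁻¹ * h * g) ∘ fun h : G => g * h * g⁻¹) = id := by
    funext h; simp [mul_assoc]
  rw [this, modelDeriv_id]

lemma Ad_inv_mul (g : G) : Ad (E := E) g⁻¹ * Ad g = 1 := by
  refine LinearMap.ext fun v => ?_
  have h := DFunLike.congr_fun (modelDeriv_conj_inv (E := E) g 1) v
  rw [mul_one, mul_inv_cancel] at h
  rw [Module.End.mul_apply, Ad_apply, Ad_apply, inv_inv]
  exact h

lemma Ad_mul_inv (g : G) : Ad (E := E) g * Ad g⁻¹ = 1 := by
  have h := Ad_inv_mul (E := E) g⁻¹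
  rwa [inv_inv] at h

/-- Chain rule at `1` for the identity that conjugation by `g` after left translation by `x` is left
translation by `g x g⁻¹` after that conjugation. -/
lemma modelDeriv_conj_mulInvariant (g x : G) (v : E) :
    modelDeriv (E := E) (fun h : G => g * x * g⁻¹ * h) 1
        (modelDeriv (fun h : G => g * h * g⁻¹) 1 v) =
      modelDeriv (fun h : G => g * h * g⁻¹) x (modelDeriv (fun h : G => x * h) 1 v) := by
  have h1 := modelDeriv_comp (E := E) (f₁ := fun h : G => g * x * g⁻¹ * h)
    (f₂ := fun h : G => g * h * g⁻¹) 1 (mdifferentiableAt_mul_left _ _)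
    (mdifferentiableAt_conj g 1)
  have h2 := modelDeriv_comp (E := E) (f₁ := fun h : G => g * h * g⁻¹)
    (f₂ := fun h : G => x * h) 1 (mdifferentiableAt_conj g _) (mdifferentiableAt_mul_left x 1)
  have h3 : ((fun h : G => g * x * g⁻¹ * h) ∘ fun h : G => g * h * g⁻¹) =
      (fun h : G => g * h * g⁻¹) ∘ fun h : G => x * h := by
    funext h; simp [mul_assoc]
  rw [h3, h2] at h1
  have h4 := DFunLike.congr_fun h1 v
  simp only [mul_one, mul_inv_cancel] at h4
  exact h4.symm

lemma mpullback_conj (g : G) (v : GroupLieAlgebra 𝓘(ℝ, E) G) :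
    VectorField.mpullback 𝓘(ℝ, E) 𝓘(ℝ, E) (fun h : G => g * h * g⁻¹)
      (mulInvariantVectorField (Ad g v)) = mulInvariantVectorField v := by
  funext x
  let A : E →L[ℝ] E := modelDeriv (fun h : G => g * h * g⁻¹) x
  let A' : E →L[ℝ] E := modelDeriv (fun h : G => g⁻¹ * h * g) (g * x * g⁻¹)
  have hA : A'.comp A = ContinuousLinearMap.id ℝ E := modelDeriv_conj_inv g x
  have hA' : A.comp A' = ContinuousLinearMap.id ℝ E := by
    have h := modelDeriv_conj_inv (E := E) g⁻¹ (g * x * g⁻¹)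
    rw [inv_inv] at h
    have hx : g⁻¹ * (g * x * g⁻¹) * g = x := by simp [mul_assoc]
    rw [hx] at h
    exact h
  have hinv : A.inverse = A' := ContinuousLinearMap.inverse_eq hA' hA
  have h : ∀ u : E, A.inverse (modelDeriv (fun h : G => g * x * g⁻¹ * h) 1
      (modelDeriv (fun h : G => g * h * g⁻¹) 1 u)) = modelDeriv (fun h : G => x * h) 1 u := by
    intro u
    rw [modelDeriv_conj_mulInvariant, hinv]
    exact DFunLike.congr_fun hA _
  exact h v

lemma one_add_conjR (R : Module.End ℝ (GroupLieAlgebra 𝓘(ℝ, E) G)) (a : ℝ) (g : G) :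
    1 + a • conjR R g = Ad g⁻¹ * (1 + a • R) * Ad g := by
  rw [mul_add, add_mul, mul_one, Ad_inv_mul, conjR, mul_smul_comm, smul_mul_assoc]

/-- `1 + a R_g` is conjugate to `1 + a R` by the unit `Ad g`. The formula for the inverse serves
continuity: only `Ad` depends on the group element. -/
lemma inverse_one_add_conjR {R : Module.End ℝ (GroupLieAlgebra 𝓘(ℝ, E) G)} (a : ℝ)
    (hu : IsUnit (1 + a • R)) (g : G) :
    IsUnit (1 + a • conjR R g) ∧ Ring.inverse (1 + a • conjR R g) =
      Ad g⁻¹ * Ring.inverse (1 + a • R) * Ad g := by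
  let u : (Module.End ℝ (GroupLieAlgebra 𝓘(ℝ, E) G))ˣ :=
    ⟨Ad g, Ad g⁻¹, Ad_mul_inv g, Ad_inv_mul g⟩
  obtain ⟨v, hv⟩ := hu
  have h1 : 1 + a • conjR R g = ((u⁻¹ * v * u : (Module.End ℝ (GroupLieAlgebra 𝓘(ℝ, E) G))ˣ) :
      Module.End ℝ (GroupLieAlgebra 𝓘(ℝ, E) G)) := by
    rw [one_add_conjR, ← hv]; rfl
  refine ⟨h1 ▸ Units.isUnit _, ?_⟩
  rw [h1, Ring.inverse_unit, ← hv, Ring.inverse_unit, mul_inv_rev, mul_inv_rev, inv_inv,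
    ← mul_assoc]
  rfl

variable [FiniteDimensional ℝ E]

/-- Conjugation by `g` pulls the left-invariant field of `Ad g v` back to that of `v`, and the
bracket of vector fields is natural under pullback. -/
lemma Ad_lie (g : G) (v w : GroupLieAlgebra 𝓘(ℝ, E) G) : Ad g ⁅v, w⁆ = ⁅Ad g v, Ad g w⁆ := by
  have h := VectorField.mpullback_mlieBracket (I := 𝓘(ℝ, E)) (I' := 𝓘(ℝ, E)) (n := ∞)
    (f := fun h : G => g * h * g⁻¹) (V := mulInvariantVectorField (Ad g v))
    (W := mulInvariantVectorField (Ad g w)) (x₀ := 1)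
    (mdifferentiableAt_mulInvariantVectorField _) (mdifferentiableAt_mulInvariantVectorField _)
    (contMDiff_conj g).contMDiffAt (by
      rw [minSmoothness_of_isRCLikeNormedField]; exact ENat.LEInfty.out)
  rw [mpullback_conj, mpullback_conj] at h
  -- The base point `g * 1 * g⁻¹` is not syntactically `1` and tangent spaces depend on it, hence
  -- the statement for an arbitrary `x = 1`.
  have hx : ∀ x : G, x = 1 → (VectorField.mlieBracket 𝓘(ℝ, E)
      (mulInvariantVectorField (Ad g v)) (mulInvariantVectorField (Ad g w)) x : E) =
      (⁅Ad g v, Ad g w⁆ : GroupLieAlgebra 𝓘(ℝ, E) G) := by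
    rintro x rfl; rfl
  let A : E →L[ℝ] E := modelDeriv (fun h : G => g * h * g⁻¹) 1
  let A' : E →L[ℝ] E := modelDeriv (fun h : G => g⁻¹ * h * g) (g * 1 * g⁻¹)
  have hA : A'.comp A = ContinuousLinearMap.id ℝ E := modelDeriv_conj_inv g 1
  have hA' : A.comp A' = ContinuousLinearMap.id ℝ E := by
    have h := modelDeriv_conj_inv (E := E) g⁻¹ (g * 1 * g⁻¹)
    rw [inv_inv] at h
    have hx : g⁻¹ * (g * 1 * g⁻¹) * g = 1 := by simp
    rw [hx] at h
    exact h
  have hinv : A.inverse = A' := ContinuousLinearMap.inverse_eq hA' hA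
  have h2 : A.inverse (VectorField.mlieBracket 𝓘(ℝ, E)
      (mulInvariantVectorField (Ad g v)) (mulInvariantVectorField (Ad g w)) (g * 1 * g⁻¹) : E) =
      (⁅v, w⁆ : GroupLieAlgebra 𝓘(ℝ, E) G) := h
  rw [hx (g * 1 * g⁻¹) (by simp), hinv] at h2
  change A (⁅v, w⁆ : GroupLieAlgebra 𝓘(ℝ, E) G) = _
  rw [← h2]
  exact DFunLike.congr_fun hA' _

/-- The adjoint action as an automorphism of the Lie algebra. -/
def AdEquiv (g : G) : GroupLieAlgebra 𝓘(ℝ, E) G ≃ₗ⁅ℝ⁆ GroupLieAlgebra 𝓘(ℝ, E) G :=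
  { Ad g with
    map_lie' := Ad_lie g _ _
    invFun := Ad g⁻¹
    left_inv := fun v => DFunLike.congr_fun (Ad_inv_mul g) v
    right_inv := fun v => DFunLike.congr_fun (Ad_mul_inv g) v }

lemma kap_Ad (g : G) (v w : GroupLieAlgebra 𝓘(ℝ, E) G) : kap (Ad g v) (Ad g w) = kap v w := by
  have h := LieAlgebra.killingForm_of_equiv_apply (AdEquiv (E := E) g) v w
  simp only [kap, LinearMap.neg_apply]
  exact congrArg Neg.neg h

variable {R : Module.End ℝ (GroupLieAlgebra 𝓘(ℝ, E) G)}

lemma isSkew_conjR (hR : IsSkew R) (g : G) : IsSkew (conjR R g) := by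
  have hA : ∀ x : GroupLieAlgebra 𝓘(ℝ, E) G, Ad g (Ad g⁻¹ x) = x := fun x =>
    DFunLike.congr_fun (Ad_mul_inv g) x
  intro X Y
  simp only [conjR, Module.End.mul_apply]
  rw [← kap_Ad g, hA, hR, ← kap_Ad g X, hA]

end Group

/-! ### Invertibility of `1 + a R` from that of `1 - a R`. -/

section Skew

variable {L : Type*} [LieRing L] [LieAlgebra ℝ L] [Module.Finite ℝ L] {R : Module.End ℝ L}

/-- The two operators are `κ`-adjoint, so the kernel of `1 + a R` is orthogonal to the range of `1 -
a R`, which is everything. -/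
lemma isUnit_one_add_of_isUnit_one_sub (hκ : (kap : LinearMap.BilinForm ℝ L).Nondegenerate)
    (hR : IsSkew R) {a : ℝ} (hu : IsUnit (1 - a • R)) : IsUnit (1 + a • R) := by
  have hinj : Function.Injective ((1 + a • R : Module.End ℝ L) : L → L) := by
    refine (injective_iff_map_eq_zero _).2 fun x hx => ?_
    have h : ∀ y, kap x ((1 - a • R) y) = 0 := by
      intro y
      have h1 : kap ((1 + a • R) x) y = 0 := by rw [hx]; simp
      rw [LinearMap.add_apply, map_add, LinearMap.add_apply, LinearMap.smul_apply, map_smul,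
        LinearMap.smul_apply, hR, Module.End.one_apply] at h1
      rw [LinearMap.sub_apply, map_sub, LinearMap.smul_apply, map_smul, Module.End.one_apply]
      simpa [sub_eq_add_neg] using h1
    refine hκ.1 _ fun y => ?_
    have h2 := DFunLike.congr_fun (Ring.mul_inverse_cancel _ hu) y
    rw [Module.End.mul_apply, Module.End.one_apply] at h2
    rw [← h2]
    exact h _
  rw [Module.End.isUnit_iff]
  exact ⟨hinj, LinearMap.injective_iff_surjective.1 hinj⟩

end Skew

/-! ### Continuity of `Ad` and of the currents. -/

section Continuity

lemma continuous_linearMap_apply {V W P : Type*} [AddCommGroup V] [Module ℝ V]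
    [TopologicalSpace V] [IsTopologicalAddGroup V] [ContinuousSMul ℝ V] [T2Space V]
    [FiniteDimensional ℝ V] [AddCommGroup W] [Module ℝ W] [TopologicalSpace W]
    [IsTopologicalAddGroup W] [ContinuousSMul ℝ W] [TopologicalSpace P]
    {T : P → V →ₗ[ℝ] W} (hT : ∀ a, Continuous fun p => T p a)
    {x : P → V} (hx : Continuous x) : Continuous fun p => T p (x p) := by
  let b := Module.finBasis ℝ V
  have h : ∀ p, T p (x p) = ∑ i, b.coord i (x p) • T p (b i) := by
    intro p
    conv_lhs => rw [← b.sum_repr (x p)]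
    simp only [map_sum, map_smul, Module.Basis.coord_apply]
  simp only [h]
  exact continuous_finsetSum _ fun i _ =>
    ((LinearMap.continuous_of_finiteDimensional (b.coord i)).comp hx).smul (hT _)

variable {E : Type*} [NormedAddCommGroup E] [NormedSpace ℝ E]
  {G : Type*} [TopologicalSpace G] [ChartedSpace E G] [Group G] [LieGroup 𝓘(ℝ, E) ∞ G]

/-- The derivatives of a smooth family of maps at points with a fixed image depend continuously on
the parameter. -/
lemma continuous_mfderiv_family {F F' : Type*} [NormedAddCommGroup F] [NormedSpace ℝ F]
    [NormedAddCommGroup F'] [NormedSpace ℝ F'] {M N : Type*} [TopologicalSpace M]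
    [ChartedSpace F M] [IsManifold 𝓘(ℝ, F) 1 M] [TopologicalSpace N] [ChartedSpace F' N]
    [IsManifold 𝓘(ℝ, F') 1 N] (f : N → M → G) (γ : N → M)
    (hf : ContMDiff (𝓘(ℝ, F').prod 𝓘(ℝ, F)) 𝓘(ℝ, E) ∞ (Function.uncurry f))
    (hγ : ContMDiff 𝓘(ℝ, F') 𝓘(ℝ, F) ∞ γ)
    (hsrc : ∀ x x₀ v, (tangentBundleCore 𝓘(ℝ, F) M).coordChange (achart F (γ x₀))
      (achart F (γ x)) (γ x) v = v)
    (hloc : ∀ x x₀, γ x ∈ (chartAt F (γ x₀)).source)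
    {c : G} (hc : ∀ x, f x (γ x) = c) (u : F) :
    Continuous fun x => (show F →L[ℝ] E from mfderiv 𝓘(ℝ, F) 𝓘(ℝ, E) (f x) (γ x)) u := by
  rw [continuous_iff_continuousAt]
  intro x₀
  have h := ContMDiffAt.mfderiv (J := 𝓘(ℝ, F')) (I := 𝓘(ℝ, F)) (I' := 𝓘(ℝ, E)) (m := 0) (n := ∞)
    (x₀ := x₀) f γ hf.contMDiffAt (hγ.contMDiffAt.of_le zero_le) (by simp)
  -- Since the image point never moves and the source changes of coordinates are trivial, reading
  -- the derivative in tangent coordinates changes nothing.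
  have h2 : ∀ (ϕ : N → F →L[ℝ] E) (ψ : N → G), (∀ x, ψ x = c) →
      inTangentCoordinates 𝓘(ℝ, F) 𝓘(ℝ, E) γ ψ ϕ x₀ = ϕ := by
    intro ϕ ψ hψ
    obtain rfl : ψ = fun _ => c := funext hψ
    funext x
    rw [inTangentCoordinates_eq _ _ _ (hloc x x₀) (mem_chart_source E c)]
    refine ContinuousLinearMap.ext fun v => ?_
    simp only [ContinuousLinearMap.comp_apply, hsrc]
    exact (tangentBundleCore 𝓘(ℝ, E) G).coordChange_self _ _ (mem_chart_source E c) _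
  let ϕ : N → F →L[ℝ] E := fun x => mfderiv 𝓘(ℝ, F) 𝓘(ℝ, E) (f x) (γ x)
  have h3 : ContMDiffAt 𝓘(ℝ, F') 𝓘(ℝ, F →L[ℝ] E) 0
    (inTangentCoordinates 𝓘(ℝ, F) 𝓘(ℝ, E) γ (fun x => f x (γ x)) ϕ x₀) x₀ := h
  rw [h2 ϕ _ hc] at h3
  exact h3.continuousAt.clm_apply continuousAt_const

lemma continuous_Ad (v : GroupLieAlgebra 𝓘(ℝ, E) G) : Continuous fun g : G => Ad (E := E) g v := by
  refine continuous_mfderiv_family (E := E) (F := E) (F' := E) (M := G) (N := G)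
    (fun g h => g * h * g⁻¹) (fun _ => 1) ?_ contMDiff_const ?_ ?_ (c := 1) (by simp) v
  · have h1 : ContMDiff (𝓘(ℝ, E).prod 𝓘(ℝ, E)) 𝓘(ℝ, E) ∞ (Prod.fst : G × G → G) :=
      contMDiff_fst
    have h2 : ContMDiff (𝓘(ℝ, E).prod 𝓘(ℝ, E)) 𝓘(ℝ, E) ∞ (Prod.snd : G × G → G) :=
      contMDiff_snd
    exact (h1.mul h2).mul h1.inv
  · intro x x₀ v
    exact (tangentBundleCore 𝓘(ℝ, E) G).coordChange_self _ _ (mem_chart_source E 1) _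
  · intro x x₀
    exact mem_chart_source E 1

/-- Written this way, the map being differentiated sends `p` to `1` for every `p`, the fixed image
that `continuous_mfderiv_family` needs. -/
lemma leftCurrent_eq {g : ℝ × ℝ → G} (hg : ContMDiff 𝓘(ℝ, ℝ × ℝ) 𝓘(ℝ, E) ∞ g) (u p : ℝ × ℝ) :
    leftCurrent (E := E) g u p = (show ℝ × ℝ →L[ℝ] E from
      mfderiv 𝓘(ℝ, ℝ × ℝ) 𝓘(ℝ, E) (fun q => (g p)⁻¹ * g q) p) u := by
  have h := mfderiv_comp (I := 𝓘(ℝ, ℝ × ℝ)) (I' := 𝓘(ℝ, E)) (I'' := 𝓘(ℝ, E)) p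
    (g := fun h : G => (g p)⁻¹ * h) (f := g) (mdifferentiableAt_mul_left _ _)
    (hg.mdifferentiableAt (by simp))
  exact (DFunLike.congr_fun h u).symm

lemma continuous_leftCurrent {g : ℝ × ℝ → G} (hg : ContMDiff 𝓘(ℝ, ℝ × ℝ) 𝓘(ℝ, E) ∞ g)
    (u : ℝ × ℝ) : Continuous fun p => leftCurrent (E := E) g u p := by
  have h := continuous_mfderiv_family (E := E) (F := ℝ × ℝ) (F' := ℝ × ℝ) (M := ℝ × ℝ)
    (N := ℝ × ℝ) (fun p q => (g p)⁻¹ * g q) id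
    ((hg.comp contMDiff_fst).inv.mul (hg.comp contMDiff_snd)) contMDiff_id
    (by simp)
    (fun x x₀ => by rw [chartAt_self_eq]; trivial) (c := 1) (by simp) u
  refine h.congr fun p => ?_
  rw [leftCurrent_eq hg]
  rfl

lemma continuous_jLC {n : ℕ} {g : Fin (n + 1) → ℝ × ℝ → G}
    (hg : ∀ r, ContMDiff 𝓘(ℝ, ℝ × ℝ) 𝓘(ℝ, E) ∞ (g r)) (s : ℤˣ)
    (r : Fin (n + 1)) : Continuous fun p => jLC (E := E) g s p r :=
  (continuous_leftCurrent (E := E) (hg r) (1, 0)).add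
    ((continuous_leftCurrent (E := E) (hg r) (0, 1)).const_smul (sgn s))

end Continuity

/-! ### From Lagrangian densities to actions. -/

section Integration

/-- Integration of a pointwise identity of Lagrangian densities over a window of space-time. -/
lemma integral_lagrangian {ι : Type*} [Fintype ι] {T S : Set ℝ} {F : ι → ℝ × ℝ → ℝ}
    {H Q : ℝ × ℝ → ℝ} {I : Finset ι} {k : ι → ℝ} {W : ι → ℝ × ℝ → ℝ}
    (hF : ∀ r, IntegrableOn (F r) (T ×ˢ S)) (hQ : IntegrableOn Q (T ×ˢ S))
    (hW : ∀ r ∈ I, IntegrableOn (W r) (T ×ˢ S))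
    (h : ∀ p, ∑ r, F r p - H p = Q p + ∑ r ∈ I, k r * W r p) :
    ∑ r, (∫ t in T, ∫ x in S, F r (t, x)) - ∫ t in T, ∫ x in S, H (t, x) =
      (∫ t in T, ∫ x in S, Q (t, x)) + ∑ r ∈ I, k r * ∫ t in T, ∫ x in S, W r (t, x) := by
  have hsF : IntegrableOn (fun p => ∑ r, F r p) (T ×ˢ S) :=
    integrable_finsetSum _ fun r _ => hF r
  have hsW : IntegrableOn (fun p => ∑ r ∈ I, k r * W r p) (T ×ˢ S) :=
    integrable_finsetSum _ fun r hr => (hW r hr).const_mul (k r)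
  -- Integrability of the Hamiltonian density is deduced from the identity rather than assumed.
  have hH' : H = fun p => ∑ r, F r p - (Q p + ∑ r ∈ I, k r * W r p) := by
    funext p; linarith [h p]
  have hH : IntegrableOn H (T ×ˢ S) := by
    rw [hH']; exact hsF.sub (hQ.add hsW)
  rw [Measure.volume_eq_prod] at *
  have h1 : ∑ r, (∫ t in T, ∫ x in S, F r (t, x)) =
      ∫ p in T ×ˢ S, ∑ r, F r p ∂(volume.prod volume) := by
    rw [integral_finsetSum _ fun r _ => hF r]
    exact Finset.sum_congr rfl fun r _ => (setIntegral_prod _ (hF r)).symm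
  have h2 : ∑ r ∈ I, k r * (∫ t in T, ∫ x in S, W r (t, x)) =
      ∫ p in T ×ˢ S, ∑ r ∈ I, k r * W r p ∂(volume.prod volume) := by
    rw [integral_finsetSum _ fun r hr => (hW r hr).const_mul (k r)]
    refine Finset.sum_congr rfl fun r hr => ?_
    rw [integral_const_mul, setIntegral_prod _ (hW r hr)]
  rw [h1, h2, ← setIntegral_prod _ hH, ← setIntegral_prod _ hQ, ← integral_sub hsF hH,
    ← integral_add hQ hsW]
  exact integral_congr_ae (ae_of_all _ h)

end Integration

/-! ### Fields on space-time: momenta, continuity and the Lagrangian. -/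

section Fields

variable {E : Type*} [NormedAddCommGroup E] [NormedSpace ℝ E] [FiniteDimensional ℝ E]
  {G : Type*} [TopologicalSpace G] [ChartedSpace E G] [Group G] [LieGroup 𝓘(ℝ, E) ∞ G]
  {n : ℕ} {D : GaudinData n} {R : Module.End ℝ (GroupLieAlgebra 𝓘(ℝ, E) G)}
  {B : Fin (n + 1) → TwoForm E G} {g : Fin (n + 1) → ℝ × ℝ → G}

instance : T2Space (GroupLieAlgebra 𝓘(ℝ, E) G) := inferInstanceAs (T2Space E)

lemma continuous_kap {P : Type*} [TopologicalSpace P] {x y : P → GroupLieAlgebra 𝓘(ℝ, E) G}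
    (hx : Continuous x) (hy : Continuous y) : Continuous fun p => kap (x p) (y p) := by
  refine continuous_linearMap_apply (T := fun p => kap (x p)) (fun a => ?_) hy
  simp_rw [kap_comm _ a]
  exact continuous_linearMap_apply (T := fun _ => kap a) (fun _ => continuous_const) hx

lemma continuous_conj_end {P : Type*} [TopologicalSpace P]
    (T : Module.End ℝ (GroupLieAlgebra 𝓘(ℝ, E) G)) {h : P → G} (hh : Continuous h)
    {x : P → GroupLieAlgebra 𝓘(ℝ, E) G} (hx : Continuous x) :
    Continuous fun p => (Ad (h p)⁻¹ * T * Ad (h p) :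
      Module.End ℝ (GroupLieAlgebra 𝓘(ℝ, E) G)) (x p) := by
  have : IsTopologicalGroup G := topologicalGroup_of_lieGroup 𝓘(ℝ, E) ∞
  simp only [Module.End.mul_apply]
  exact continuous_linearMap_apply (T := fun p => Ad (h p)⁻¹)
    (fun a => (continuous_Ad a).comp hh.inv)
    (continuous_linearMap_apply (T := fun _ => T) (fun a => continuous_const)
      (continuous_linearMap_apply (T := fun p => Ad (h p))
        (fun a => (continuous_Ad a).comp hh) hx))

lemma isUnit_one_add_sgn
    (hκ : (kap : LinearMap.BilinForm ℝ (GroupLieAlgebra 𝓘(ℝ, E) G)).Nondegenerate)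
    (hskew : IsSkew R) (hinv : IsUnit (1 - D.theta • R)) (s : ℤˣ) :
    IsUnit (1 + (sgn s * D.theta) • R) := by
  rcases Int.units_eq_one_or s with rfl | rfl
  · rw [sgn_one, one_mul]
    exact isUnit_one_add_of_isUnit_one_sub hκ hskew hinv
  · rwa [sgn_neg_one, neg_one_mul, neg_smul, ← sub_eq_add_neg]

lemma continuous_hybCurrents (hg : ∀ r, ContMDiff 𝓘(ℝ, ℝ × ℝ) 𝓘(ℝ, E) ∞ (g r)) (s : ℤˣ)
    (hu : IsUnit (1 + (sgn s * D.theta) • R)) (r : Fin (n + 1)) :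
    Continuous fun p => hybCurrents D R g s p r := by
  rcases eq_or_ne r (Fin.last n) with rfl | hr
  · simp only [hybCurrents, Function.update_self, deformedCurrent,
      (inverse_one_add_conjR _ hu _).2]
    refine continuous_conj_end _ (hg _).continuous ((continuous_jLC hg s _).sub ?_)
    refine Continuous.const_smul (continuous_finsetSum _ fun r _ => ?_) _
    exact (continuous_conj_end R (hg _).continuous (continuous_jLC hg s r)).const_smul _
  · simp only [hybCurrents, Function.update_of_ne hr]
    exact continuous_jLC hg s r

lemma continuous_hybSigmaDensity (hg : ∀ r, ContMDiff 𝓘(ℝ, ℝ × ℝ) 𝓘(ℝ, E) ∞ (g r))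
    (hinv : IsUnit (1 - D.theta • R)) : Continuous (hybSigmaDensity D R g) := by
  have hinv' : IsUnit (1 + (-D.theta) • R) := by rwa [neg_smul, ← sub_eq_add_neg]
  have h : ∀ p, 1 - D.theta • conjR R (g (Fin.last n) p) =
      1 + (-D.theta) • conjR R (g (Fin.last n) p) := fun p => by
    rw [neg_smul, ← sub_eq_add_neg]
  unfold hybSigmaDensity
  refine continuous_finsetSum _ fun r _ => continuous_finsetSum _ fun s _ => ?_
  refine continuous_kap (continuous_jLC hg 1 r) ?_
  simp only [opO, LinearMap.add_apply, LinearMap.smul_apply, Module.End.one_apply, h,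
    (inverse_one_add_conjR _ hinv' _).2]
  refine ((continuous_jLC hg (-1) s).const_smul _).add (Continuous.const_smul ?_ _)
  exact continuous_conj_end R (hg _).continuous
    (continuous_conj_end _ (hg _).continuous (continuous_jLC hg (-1) s))

lemma continuous_wz {U : Set G} {b : TwoForm E G} (hB : IsWZPrimitive U b) {h : ℝ × ℝ → G}
    (hh : ContMDiff 𝓘(ℝ, ℝ × ℝ) 𝓘(ℝ, E) ∞ h) (hU : ∀ p, h p ∈ U) (u v : ℝ × ℝ) :
    Continuous fun p => b (h p) (leftCurrent h u p) (leftCurrent h v p) := by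
  refine continuous_linearMap_apply (T := fun p => b (h p) (leftCurrent h u p)) (fun a => ?_)
    (continuous_leftCurrent hh v)
  refine continuous_linearMap_apply (T := fun p => (b (h p)).flip a) (fun c => ?_)
    (continuous_leftCurrent hh u)
  exact (hB.smooth c a).continuousOn.comp_continuous hh.continuous hU

lemma isHybMomentum_iff (hD : D.Admissible)
    (hκ : (kap : LinearMap.BilinForm ℝ (GroupLieAlgebra 𝓘(ℝ, E) G)).Nondegenerate)
    (hskew : IsSkew R) (X : ℝ × ℝ → Fin (n + 1) → GroupLieAlgebra 𝓘(ℝ, E) G) :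
    IsHybMomentum D R B g X ↔ ∀ p r, jT g p r =
      siteM D 1 (hybCurrent0 D (jX g p) (wzCurrent B g p) (X p))
        (hybCurrent1 D (conjR R (g (Fin.last n) p)) (jX g p) (X p)) r +
      if r = Fin.last n then conjR R (g (Fin.last n) p)
        (siteM D 2 (hybCurrent0 D (jX g p) (wzCurrent B g p) (X p))
          (hybCurrent1 D (conjR R (g (Fin.last n) p)) (jX g p) (X p)) (Fin.last n)) else 0 :=
  forall_congr' fun _ => isVelocity_hyb_iff hD hκ (isSkew_conjR hskew _) _ _ _ _

lemma isUndefMomentum_iff (hD : D.Admissible)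
    (hκ : (kap : LinearMap.BilinForm ℝ (GroupLieAlgebra 𝓘(ℝ, E) G)).Nondegenerate)
    (X : ℝ × ℝ → Fin (n + 1) → GroupLieAlgebra 𝓘(ℝ, E) G) :
    IsUndefMomentum D B g X ↔ ∀ p r, jT g p r =
      siteM D 1 (pcmCurrent0 D (jX g p) (wzCurrent B g p) (X p)) (pcmCurrent1 D (jX g p)) r :=
  forall_congr' fun _ => isVelocity_pcm_iff hD hκ _ _ _ _

/-- The Hamilton equations contain no derivatives of the momenta, so they are solved independently
at each space-time point. -/
lemma existsUnique_pi {α β : Type*} {P : α → β → Prop} (h : ∀ a, ∃! b, P a b) :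
    ∃! f : α → β, ∀ a, P a (f a) := by
  choose f hf hu using h
  exact ⟨f, hf, fun f' hf' => funext fun a => hu a _ (hf' a)⟩

lemma siteLax_hybMomentum (hD : D.Admissible) (hk : D.k (Fin.last n) = 0)
    (hκ : (kap : LinearMap.BilinForm ℝ (GroupLieAlgebra 𝓘(ℝ, E) G)).Nondegenerate)
    (hskew : IsSkew R) (hinv : IsUnit (1 - D.theta • R))
    {X : ℝ × ℝ → Fin (n + 1) → GroupLieAlgebra 𝓘(ℝ, E) G} (hX : IsHybMomentum D R B g X)
    (s : ℤˣ) (p : ℝ × ℝ) :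
    siteLax D s 1 (hybCurrent0 D (jX g p) (wzCurrent B g p) (X p))
      (hybCurrent1 D (conjR R (g (Fin.last n) p)) (jX g p) (X p)) = hybCurrents D R g s p :=
  siteLax_hyb hD hk (hybCurrent1_apply _ _ _ _) ((isHybMomentum_iff hD hκ hskew X).1 hX p) s
    (inverse_one_add_conjR _ (isUnit_one_add_sgn hκ hskew hinv s) _).1

/-- Nothing is known in advance about the regularity of `X`. By `currents_eq` and interpolation,
`𝒥_[0]` is a fixed linear combination of the continuous currents `hybCurrents`. -/
lemma continuous_kap_momentum (hD : D.Admissible) (hk : D.k (Fin.last n) = 0)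
    (hκ : (kap : LinearMap.BilinForm ℝ (GroupLieAlgebra 𝓘(ℝ, E) G)).Nondegenerate)
    (hskew : IsSkew R) (hinv : IsUnit (1 - D.theta • R))
    {U : Fin (n + 1) → Set G} (hB : ∀ r, r ≠ Fin.last n → IsWZPrimitive (U r) (B r))
    (hg : ∀ r, ContMDiff 𝓘(ℝ, ℝ × ℝ) 𝓘(ℝ, E) ∞ (g r))
    (hU : ∀ r, r ≠ Fin.last n → ∀ p, g r p ∈ U r)
    {X : ℝ × ℝ → Fin (n + 1) → GroupLieAlgebra 𝓘(ℝ, E) G} (hX : IsHybMomentum D R B g X)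
    (r : Fin (n + 1)) : Continuous fun p => kap (X p r) (jT g p r) := by
  have hT : Continuous fun p => jT (E := E) g p r := continuous_leftCurrent (hg r) _
  have hJ : Continuous fun p => jX (E := E) g p r := continuous_leftCurrent (hg r) _
  have hL := fun s q => continuous_hybCurrents (D := D) hg s
    (isUnit_one_add_sgn hκ hskew hinv s) q
  have hA : Continuous fun p => hybCurrent0 D (jX g p) (wzCurrent B g p) (X p) r := by
    have h : ∀ p, hybCurrent0 D (jX g p) (wzCurrent B g p) (X p) r =
        (D.ell r / 2) • (∑ q, D.derivCoeff 1 r q • hybCurrents D R g 1 p q -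
          ∑ q, D.derivCoeff (-1) r q • hybCurrents D R g (-1) p q) -
        D.k r • (hybCurrents D R g 1 p r - hybCurrents D R g (-1) p r) := by
      intro p
      rw [currents_eq hD (hybCurrent0 D (jX g p) (wzCurrent B g p) (X p)) (hybCurrent1 D (conjR R (g (Fin.last n) p)) (jX g p) (X p)) r,
        siteLax_two hD, siteLax_two hD]
      simp only [siteLax_hybMomentum hD hk hκ hskew hinv hX]
    simp only [h]
    refine (Continuous.const_smul (Continuous.sub ?_ ?_) _).sub
      (((hL 1 r).sub (hL (-1) r)).const_smul _)
    · exact continuous_finsetSum _ fun q _ => (hL 1 q).const_smul _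
    · exact continuous_finsetSum _ fun q _ => (hL (-1) q).const_smul _
  rcases eq_or_ne r (Fin.last n) with rfl | hr
  · have h : ∀ p, X p (Fin.last n) =
        hybCurrent0 D (jX g p) (wzCurrent B g p) (X p) (Fin.last n) := fun p => by
      simp [hybCurrent0]
    simp only [h]
    exact continuous_kap hA hT
  -- Continuity of `W` itself is not needed: it enters only through `κ(W, j_0) = Λ(∂_x g, ∂_t g)`,
  -- which is continuous because `Λ` has smooth coefficients.
  · have h : ∀ p, kap (X p r) (jT g p r) =
        kap (hybCurrent0 D (jX g p) (wzCurrent B g p) (X p) r) (jT g p r) +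
        D.k r * kap (jX (E := E) g p r) (jT g p r) + D.k r * B r (g r p) (jX g p r) (jT g p r) := by
      intro p
      rw [← kap_sharp hκ (B r (g r p) (jX g p r))]
      simp only [hybCurrent0, Function.update_of_ne hr, pcmCurrent0, map_sub, map_smul,
        LinearMap.sub_apply, LinearMap.smul_apply, smul_eq_mul]
      rw [wzCurrent]
      ring
    simp only [h]
    exact ((continuous_kap hA hT).add (continuous_const.mul (continuous_kap hJ hT))).add
      (continuous_const.mul (continuous_wz (hB r hr) (hg r) (hU r hr) _ _))

/-- The Lagrangian density of the deformed model. -/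
lemma hyb_lagrangian (hD : D.Admissible) (hk : D.k (Fin.last n) = 0)
    (hκ : (kap : LinearMap.BilinForm ℝ (GroupLieAlgebra 𝓘(ℝ, E) G)).Nondegenerate)
    (hskew : IsSkew R) (hinv : IsUnit (1 - D.theta • R))
    {X : ℝ × ℝ → Fin (n + 1) → GroupLieAlgebra 𝓘(ℝ, E) G} (hX : IsHybMomentum D R B g X)
    (p : ℝ × ℝ) :
    ∑ r, kap (X p r) (jT g p r) - hybHam D R B g p (X p) =
      hybSigmaDensity D R g p + ∑ r ∈ Finset.univ.erase (Fin.last n),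
        D.k r * B r (g r p) (jX g p r) (jT g p r) := by
  have hv := (isHybMomentum_iff hD hκ hskew X).1 hX p
  have hu : IsUnit (1 - D.theta • conjR R (g (Fin.last n) p)) := by
    have h := (inverse_one_add_conjR (-D.theta) (R := R)
      (by rwa [neg_smul, ← sub_eq_add_neg]) (g (Fin.last n) p)).1
    rwa [neg_smul, ← sub_eq_add_neg] at h
  have hs := isSkew_conjR hskew (g (Fin.last n) p)
  rw [hybHam, lagrangian_eq_siteLax hD hk hs hv,
    sum_siteLax_eq_sum_opO hD hk hs hu (hybCurrent1_apply _ _ _ _) hv]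
  refine congrArg₂ (· + ·) rfl (Finset.sum_congr rfl fun r _ => ?_)
  rw [wzCurrent, kap_sharp hκ]

end Fields

end CoupledHYB

end

theorem mainTheorem5
    {E : Type*} [NormedAddCommGroup E] [NormedSpace ℝ E] [FiniteDimensional ℝ E]
    {G : Type*} [TopologicalSpace G] [ChartedSpace E G] [Group G] [LieGroup 𝓘(ℝ, E) ∞ G]
    (hsimple : LieAlgebra.IsSimple ℂ (ℂ ⊗[ℝ] GroupLieAlgebra 𝓘(ℝ, E) G))
    {n : ℕ} (D : GaudinData n) (hD : D.Admissible) (hkN : D.k (Fin.last n) = 0)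
    (R : Module.End ℝ (GroupLieAlgebra 𝓘(ℝ, E) G))
    (hYB : IsHomogeneousYB R) (hskew : IsSkew R)
    (hinv : IsUnit (1 - D.theta • R))
    (U : Fin (n + 1) → Set G) (B : Fin (n + 1) → TwoForm E G)
    (hB : ∀ r, r ≠ Fin.last n → IsWZPrimitive (U r) (B r)) :
    (∀ r s, (D.rho r s : ℂ) = D.rhoC r s) ∧
    (∀ A0 A1 : Fin (n + 1) → GroupLieAlgebra 𝓘(ℝ, E) G,
      (hamDensity D A0 A1 : ℂ) = hamDensityC D A0 A1) ∧
    (∀ h : G, IsUnit (1 - D.theta • conjR R h) ∧ IsUnit (1 + D.theta • conjR R h)) ∧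
    (∀ (h : G) (r : Fin (n + 1)),
      opO D (conjR R h) r (Fin.last n) =
          D.rho r (Fin.last n) • Ring.inverse (1 - D.theta • conjR R h) ∧
        opO D (conjR R h) (Fin.last n) r =
          D.rho (Fin.last n) r • Ring.inverse (1 - D.theta • conjR R h)) ∧
    ∀ g : Fin (n + 1) → ℝ × ℝ → G,
      (∀ r, ContMDiff 𝓘(ℝ, ℝ × ℝ) 𝓘(ℝ, E) ∞ (g r)) →
      (∀ r, r ≠ Fin.last n → ∀ p, g r p ∈ U r) →
      (∃! X, IsUndefMomentum D B g X) ∧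
      (∃! X, IsHybMomentum D R B g X) ∧
      (∀ X, IsHybMomentum D R B g X →
        (∀ p, ∑ r, kap (X p r) (jT g p r) - hybHam D R B g p (X p) =
          hybSigmaDensity D R g p +
            ∑ r ∈ Finset.univ.erase (Fin.last n),
              D.k r * B r (g r p) (jX g p r) (jT g p r)) ∧
        (∀ T S : Set ℝ, IsCompact T → IsCompact S →
          hybAction D R B g X T S = hybSigmaAction D R B g T S) ∧
        (∀ T S : Set ℝ, MeasurableSet T → MeasurableSet S →
          (∀ r, IntegrableOn (fun p => kap (X p r) (jT g p r)) (T ×ˢ S)) →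
          IntegrableOn (hybSigmaDensity D R g) (T ×ˢ S) →
          (∀ r, r ≠ Fin.last n →
            IntegrableOn (fun p => B r (g r p) (jX g p r) (jT g p r)) (T ×ˢ S)) →
          hybAction D R B g X T S = hybSigmaAction D R B g T S)) ∧
      (∀ X₀ X, IsUndefMomentum D B g X₀ → IsHybMomentum D R B g X →
        ∀ (s : ℤˣ) (w : ℂ) (p : ℝ × ℝ), (∀ r, w ≠ D.z r) → (∀ i, w ≠ D.zeta i) →
          undefLax D B g X₀ s w p = interpolatedLax D s (jLC g s p) w ∧
          hybLax D R B g X s w p = interpolatedLax D s (hybCurrents D R g s p) w) := by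
  have hκ := kap_nondegenerate hsimple
  have hinv' : IsUnit (1 + (-D.theta) • R) := by rwa [neg_smul, ← sub_eq_add_neg]
  have hminus : ∀ h : G, IsUnit (1 - D.theta • conjR R h) := fun h => by
    have h1 := (inverse_one_add_conjR _ hinv' h).1
    rwa [neg_smul, ← sub_eq_add_neg] at h1
  have hplus : ∀ h : G, IsUnit (1 + D.theta • conjR R h) := fun h =>
    (inverse_one_add_conjR _ (isUnit_one_add_of_isUnit_one_sub hκ hskew hinv) h).1
  refine ⟨hD.ofReal_rho, fun A0 A1 => ?_, fun h => ⟨hminus h, hplus h⟩,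
    fun h r => ⟨opO_last_right (hminus h) r, opO_last_left (hminus h) r⟩,
    fun g hg hU => ⟨?_, ?_, fun X hX => ?_, fun X₀ X hX₀ hX s w p hz hw => ⟨?_, ?_⟩⟩⟩
  · rw [hamDensity_eq hD, hamDensityC_eq hD]
  · simp only [isUndefMomentum_iff hD hκ]
    exact existsUnique_pi fun p => existsUnique_pcm hD _ _ _
  · simp only [isHybMomentum_iff hD hκ hskew]
    refine existsUnique_pi fun p => existsUnique_hyb hD hkN (fun s => ?_) _ _ _
    exact (inverse_one_add_conjR _ (isUnit_one_add_sgn hκ hskew hinv s) _).1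
  · have hL := hyb_lagrangian hD hkN hκ hskew hinv hX
    have hint : ∀ T S : Set ℝ,
        (∀ r, IntegrableOn (fun p => kap (X p r) (jT g p r)) (T ×ˢ S)) →
        IntegrableOn (hybSigmaDensity D R g) (T ×ˢ S) →
        (∀ r, r ≠ Fin.last n →
          IntegrableOn (fun p => B r (g r p) (jX g p r) (jT g p r)) (T ×ˢ S)) →
        hybAction D R B g X T S = hybSigmaAction D R B g T S := fun T S h1 h2 h3 =>
      integral_lagrangian h1 h2 (fun r hr => h3 r (Finset.ne_of_mem_erase hr)) hL
    refine ⟨hL, fun T S hT hS => ?_, fun T S _ _ => hint T S⟩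
    have hTS := hT.prod hS
    refine hint T S (fun r => ?_) ?_ fun r hr => ?_
    · exact (continuous_kap_momentum hD hkN hκ hskew hinv hB hg hU hX r).continuousOn
        |>.integrableOn_compact hTS
    · exact (continuous_hybSigmaDensity hg hinv).continuousOn.integrableOn_compact hTS
    · exact (continuous_wz (hB r hr) (hg r) (hU r hr) _ _).continuousOn.integrableOn_compact hTS
  · rw [undefLax, laxPair_eq hD s _ _ hz hw,
      siteLax_pcm hD ((isUndefMomentum_iff hD hκ X₀).1 hX₀ p)]
    rfl
  · rw [hybLax, laxPair_eq hD s _ _ hz hw, siteLax_hybMomentum hD hkN hκ hskew hinv hX]
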